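/- Theorem 1 (quenched CLT). Let $(\zeta_j)_{j\in\mathbb Z}$ be i.i.d. positive random variables with finite mean $\mu$, and let the environment $\omega=(\omega_k)_{k\in\mathbb Z}$ be given by $\omega_0=0$, $\omega_k=\omega_{k-1}+\zeta_k$ for all $k\in\mathbb Z$; let $P$ be the law of $\omega$ on the space of environments. Independently, let $(\xi_i)_{i\ge1}$ be i.i.d. $\mathbb Z$-valued random variables with $\mathrm{Prob}(\xi_i=k)=p_k$, where $p_{-k}=p_k$ for all $k$, $p_{k+1}\le p_k$ for all $k\ge1$, and $v_p=\sum_k k^2p_k\in(0,\infty)$; denote by $Q$ their law, and put $S_0=0$, $S_n=\xi_1+\dots+\xi_n$. For a fixed environment $\omega$ put $\tau(0)=0$, $\tau(n)=\sum_{k=1}^n|\omega_{S_k}-\omega_{S_{k-1}}|$, and let $X(t)$, $t\ge0$, be the continuous path $$X(t)=\omega_{S_n}+\operatorname{sgn}(\xi_{n+1})\,(t-\tau(n))\qquad\text{for }t\in[\tau(n),\tau(n+1)).$$ (The path is set to be identically $0$ where $\tau(n)\not\to\infty$.) Let $P_\omega$ be the law of $(X(t))_{t\ge0}$ on $C([0,\infty);\mathbb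 R)$ induced by $Q$. Let $\bar m=\sum_k|k|\,p_k$ and $m_2=\lim_{n\to\infty}E_Q(|S_n|^2)/n$. Then the limit $m_2$ exists and equals $v_p$, and for $P$-almost every environment $\omega$, $X(t)/\sqrt t$ converges in distribution under $P_\omega$, as $t\to\infty$, to the centered normal law with variance $\frac{\mu}{\bar m}\,m_2$. -/

import Mathlib

open MeasureTheory ProbabilityTheory Filter Topology
open scoped NNReal

noncomputable section

namespace LevyWalk

/-! ### The environment -/

/-- The distances between neighbouring targets: `ζ k` is the distance between the targets with
indices `k - 1` and `k`. -/
abbrev Gaps : Type := ℤ → Set.Ioi (0 : ℝ)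

/-- The position of the `k`-th target: `0` for `k = 0`, `ζ 1 + ⋯ + ζ k` for `k > 0` and
`-(ζ 0 + ζ (-1) + ⋯ + ζ (k + 1))` for `k < 0`. -/
def target (ζ : Gaps) (k : ℤ) : ℝ :=
  ∑ i ∈ Finset.Ioc 0 k, (ζ i : ℝ) - ∑ i ∈ Finset.Ioc k 0, (ζ i : ℝ)

theorem target_zero (ζ : Gaps) : target ζ 0 = 0 := by
  simp [target]

/-- The defining recursion `ω k = ω (k - 1) + ζ k`, for all integers `k`. -/
theorem target_eq (ζ : Gaps) (k : ℤ) : target ζ k = target ζ (k - 1) + ζ k := by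
  unfold target
  rcases le_or_gt k 0 with hk | hk
  · have h1 : Finset.Ioc (k - 1) 0 = insert k (Finset.Ioc k 0) := by
      ext i; simp only [Finset.mem_Ioc, Finset.mem_insert]; omega
    have h2 : Finset.Ioc 0 k = ∅ := Finset.Ioc_eq_empty (by omega)
    have h3 : Finset.Ioc 0 (k - 1) = ∅ := Finset.Ioc_eq_empty (by omega)
    rw [h1, h2, h3, Finset.sum_insert (by simp)]
    simp
  · have h1 : Finset.Ioc 0 k = insert k (Finset.Ioc 0 (k - 1)) := by
      ext i; simp only [Finset.mem_Ioc, Finset.mem_insert]; omega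
    have h2 : Finset.Ioc k 0 = ∅ := Finset.Ioc_eq_empty (by omega)
    have h3 : Finset.Ioc (k - 1) 0 = ∅ := Finset.Ioc_eq_empty (by omega)
    rw [h1, h2, h3, Finset.sum_insert (by simp)]
    simp [add_comm]

theorem target_strictMono (ζ : Gaps) : StrictMono (target ζ) := by
  refine strictMono_int_of_lt_succ fun k => ?_
  have h := target_eq ζ (k + 1)
  have hpos : (0 : ℝ) < ζ (k + 1) := (ζ (k + 1)).2
  rw [add_sub_cancel_right] at h
  linarith

/-- The set of all environments: strictly increasing bi-infinite sequences of targets with a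
target of index `0` at the origin. It carries the cylinder σ-algebra. -/
abbrev Environment : Type := {ω : ℤ → ℝ // ω 0 = 0 ∧ StrictMono ω}

/-- The environment with the given gaps. -/
def toEnvironment (ζ : Gaps) : Environment :=
  ⟨target ζ, target_zero ζ, target_strictMono ζ⟩

theorem measurable_toEnvironment : Measurable toEnvironment := by
  refine Measurable.subtype_mk (measurable_pi_lambda _ fun k => ?_)
  unfold target
  fun_prop

/-- The law of the environment, when the gaps are i.i.d. with law `F`. -/
def environmentLaw (F : Measure (Set.Ioi (0 : ℝ))) [IsProbabilityMeasure F] :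
    Measure Environment :=
  (Measure.infinitePi fun _ : ℤ => F).map toEnvironment

instance (F : Measure (Set.Ioi (0 : ℝ))) [IsProbabilityMeasure F] :
    IsProbabilityMeasure (environmentLaw F) :=
  Measure.isProbabilityMeasure_map measurable_toEnvironment.aemeasurable

/-- The mean gap. -/
def meanGap (F : Measure (Set.Ioi (0 : ℝ))) : ℝ := ∫ x, (x : ℝ) ∂F

/-! ### The underlying random walk -/

/-- The law of the i.i.d. sequence of increments of the underlying walk, with density `p`;
the coordinate `ξ n` is the `(n + 1)`-st increment. -/
def jumpLaw (p : PMF ℤ) : Measure (ℕ → ℤ) := Measure.infinitePi fun _ : ℕ => p.toMeasure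

instance (p : PMF ℤ) : IsProbabilityMeasure (jumpLaw p) := by
  unfold jumpLaw; infer_instance

/-- The underlying random walk: `S 0 = 0`, `S n` is the sum of the first `n` increments. -/
def walk (ξ : ℕ → ℤ) (n : ℕ) : ℤ := ∑ i ∈ Finset.range n, ξ i

/-- The mean absolute jump. -/
def meanAbsJump (p : PMF ℤ) : ℝ := ∑' k : ℤ, |(k : ℝ)| * (p k).toReal

/-- The second moment (and, for a symmetric `p`, the variance) of a jump. -/
def jumpVariance (p : PMF ℤ) : ℝ := ∑' k : ℤ, (k : ℝ) ^ 2 * (p k).toReal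

/-! ### The continuous-time process -/

/-- The collision times: `τ n` is the length of the trajectory of the walk on the targets up to
its `n`-th step. -/
def collisionTime (ω : Environment) (ξ : ℕ → ℤ) (n : ℕ) : ℝ :=
  ∑ k ∈ Finset.range n, |ω.1 (walk ξ (k + 1)) - ω.1 (walk ξ k)|

/-- The number of collisions up to time `t`: the largest `m` with `τ m ≤ t`. -/
def collisionCount (ω : Environment) (ξ : ℕ → ℤ) (t : ℝ≥0) : ℕ :=
  sSup {m : ℕ | collisionTime ω ξ m ≤ t}

/-- The position at time `t` of the particle that travels with unit speed from target to target,
following the walk. -/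
def position (ω : Environment) (ξ : ℕ → ℤ) (t : ℝ≥0) : ℝ :=
  ω.1 (walk ξ (collisionCount ω ξ t)) +
    (SignType.sign (ξ (collisionCount ω ξ t)) : ℝ) *
      (t - collisionTime ω ξ (collisionCount ω ξ t))

theorem collisionTime_mono (ω : Environment) (ξ : ℕ → ℤ) : Monotone (collisionTime ω ξ) := by
  refine monotone_nat_of_le_succ fun n => ?_
  simp [collisionTime, Finset.sum_range_succ]

theorem collisionCount_eq (ω : Environment) (ξ : ℕ → ℤ) (n : ℕ) (t : ℝ≥0)
    (h1 : collisionTime ω ξ n ≤ t) (h2 : t < collisionTime ω ξ (n + 1)) :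
    collisionCount ω ξ t = n := by
  refine IsGreatest.csSup_eq ⟨h1, fun m hm => ?_⟩
  by_contra hlt
  have := collisionTime_mono ω ξ (show n + 1 ≤ m by omega)
  exact absurd (h2.trans_le this) (not_lt.2 hm)

/-- On `[τ n, τ (n + 1))` the particle moves from the `n`-th position of the walk on the targets,
with unit speed, in the direction of the next jump. -/
theorem position_eq (ω : Environment) (ξ : ℕ → ℤ) (n : ℕ) (t : ℝ≥0)
    (h1 : collisionTime ω ξ n ≤ t) (h2 : t < collisionTime ω ξ (n + 1)) :
    position ω ξ t =
      ω.1 (walk ξ n) + (SignType.sign (ξ n) : ℝ) * (t - collisionTime ω ξ n) := by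
  rw [position, collisionCount_eq ω ξ n t h1 h2]

theorem exists_collision (ω : Environment) (ξ : ℕ → ℤ)
    (h : Tendsto (collisionTime ω ξ) atTop atTop) (t : ℝ≥0) :
    ∃ n, collisionTime ω ξ n ≤ t ∧ t < collisionTime ω ξ (n + 1) := by
  classical
  have hex : ∃ m, (t : ℝ) < collisionTime ω ξ m := (h.eventually_gt_atTop (t : ℝ)).exists
  have hpos : Nat.find hex ≠ 0 := by
    intro h0
    have h1 := Nat.find_spec hex
    rw [h0] at h1
    exact absurd h1 (by simp [collisionTime])
  obtain ⟨n, hn⟩ := Nat.exists_eq_succ_of_ne_zero hpos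
  refine ⟨n, not_lt.1 (Nat.find_min hex (by omega)), ?_⟩
  have h1 := Nat.find_spec hex
  rwa [hn] at h1

theorem target_walk_succ (ω : Environment) (ξ : ℕ → ℤ) (n : ℕ) :
    ω.1 (walk ξ (n + 1)) = ω.1 (walk ξ n) +
      (SignType.sign (ξ n) : ℝ) * (collisionTime ω ξ (n + 1) - collisionTime ω ξ n) := by
  have hS : walk ξ (n + 1) = walk ξ n + ξ n := by simp [walk, Finset.sum_range_succ]
  have hτ : collisionTime ω ξ (n + 1) - collisionTime ω ξ n =
      |ω.1 (walk ξ (n + 1)) - ω.1 (walk ξ n)| := by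
    simp [collisionTime, Finset.sum_range_succ]
  rw [hτ, hS]
  rcases lt_trichotomy (ξ n) 0 with h | h | h
  · have := ω.2.2 (show walk ξ n + ξ n < walk ξ n by omega)
    rw [abs_of_neg (by linarith), sign_neg h]
    simp
  · simp [h]
  · have := ω.2.2 (show walk ξ n < walk ξ n + ξ n by omega)
    rw [abs_of_pos (by linarith), sign_pos h]
    simp

theorem abs_sign_mul_le (k : ℤ) (x : ℝ) : |(SignType.sign k : ℝ) * x| ≤ |x| := by
  rcases lt_trichotomy k 0 with h | h | h
  · simp [sign_neg h]
  · simp [h]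
  · simp [sign_pos h]

theorem abs_target_walk_sub_le (ω : Environment) (ξ : ℕ → ℤ) {m n : ℕ} (hmn : m ≤ n) :
    |ω.1 (walk ξ n) - ω.1 (walk ξ m)| ≤ collisionTime ω ξ n - collisionTime ω ξ m := by
  induction n, hmn using Nat.le_induction with
  | base => simp
  | succ n _ ih =>
    have h : collisionTime ω ξ (n + 1) = collisionTime ω ξ n +
        |ω.1 (walk ξ (n + 1)) - ω.1 (walk ξ n)| := by
      simp [collisionTime, Finset.sum_range_succ]
    have := abs_sub_le (ω.1 (walk ξ (n + 1))) (ω.1 (walk ξ n)) (ω.1 (walk ξ m))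
    linarith

theorem abs_position_sub_le (ω : Environment) (ξ : ℕ → ℤ)
    (h : Tendsto (collisionTime ω ξ) atTop atTop) {s t : ℝ≥0} (hst : s ≤ t) :
    |position ω ξ t - position ω ξ s| ≤ t - s := by
  obtain ⟨m, hm1, hm2⟩ := exists_collision ω ξ h s
  obtain ⟨n, hn1, hn2⟩ := exists_collision ω ξ h t
  have hst' : (s : ℝ) ≤ t := by exact_mod_cast hst
  rw [position_eq ω ξ m s hm1 hm2, position_eq ω ξ n t hn1 hn2]
  rcases lt_trichotomy m n with hlt | rfl | hlt
  · have e := target_walk_succ ω ξ m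
    have b1 := abs_target_walk_sub_le ω ξ (show m + 1 ≤ n by omega)
    have b2 := abs_sign_mul_le (ξ n) (t - collisionTime ω ξ n)
    have b3 := abs_sign_mul_le (ξ m) (collisionTime ω ξ (m + 1) - s)
    rw [abs_of_nonneg (by linarith : (0 : ℝ) ≤ t - collisionTime ω ξ n)] at b2
    rw [abs_of_nonneg (by linarith : (0 : ℝ) ≤ collisionTime ω ξ (m + 1) - s)] at b3
    have key : ω.1 (walk ξ n) + (SignType.sign (ξ n) : ℝ) * (t - collisionTime ω ξ n) -
        (ω.1 (walk ξ m) + (SignType.sign (ξ m) : ℝ) * (s - collisionTime ω ξ m)) =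
        (ω.1 (walk ξ n) - ω.1 (walk ξ (m + 1))) +
          (SignType.sign (ξ n) : ℝ) * (t - collisionTime ω ξ n) +
          (SignType.sign (ξ m) : ℝ) * (collisionTime ω ξ (m + 1) - s) := by
      rw [e]; ring
    rw [key]
    refine (abs_add_three _ _ _).trans ?_
    linarith
  · have b := abs_sign_mul_le (ξ m) (t - s)
    rw [abs_of_nonneg (by linarith : (0 : ℝ) ≤ t - s)] at b
    refine le_trans (le_of_eq ?_) b
    congr 1; ring
  · have := collisionTime_mono ω ξ (show n + 1 ≤ m by omega)
    linarith

theorem continuous_position (ω : Environment) (ξ : ℕ → ℤ)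
    (h : Tendsto (collisionTime ω ξ) atTop atTop) : Continuous (position ω ξ) := by
  refine LipschitzWith.continuous (K := 1) (LipschitzWith.of_dist_le_mul fun s t => ?_)
  rw [NNReal.coe_one, one_mul, Real.dist_eq, NNReal.dist_eq]
  rcases le_total s t with hst | hst
  · rw [abs_sub_comm, abs_sub_comm (s : ℝ)]
    exact (abs_position_sub_le ω ξ h hst).trans (le_abs_self _)
  · exact (abs_position_sub_le ω ξ h hst).trans (le_abs_self _)

/-- The space of continuous paths `[0, ∞) → ℝ`, with the σ-algebra generated by the evaluations
(which is its Borel σ-algebra). -/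
abbrev PathSpace : Type := {x : ℝ≥0 → ℝ // Continuous x}

open Classical in
/-- The trajectory of the particle. It is defined for all times when the collision times tend to
infinity; in the other case, the path is set to be constantly `0`. -/
def path (ω : Environment) (ξ : ℕ → ℤ) : PathSpace :=
  if h : Tendsto (collisionTime ω ξ) atTop atTop then ⟨position ω ξ, continuous_position ω ξ h⟩
  else ⟨fun _ => 0, continuous_const⟩

theorem measurable_walk (n : ℕ) : Measurable fun ξ : ℕ → ℤ => walk ξ n := by
  unfold walk; fun_prop

theorem measurable_collisionTime (ω : Environment) (n : ℕ) :
    Measurable fun ξ : ℕ → ℤ => collisionTime ω ξ n := by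
  have h : ∀ k, Measurable fun ξ : ℕ → ℤ => ω.1 (walk ξ k) := fun k =>
    (measurable_from_top (f := ω.1)).comp (measurable_walk k)
  unfold collisionTime
  refine Finset.measurable_sum _ fun k _ => ?_
  exact ((h (k + 1)).sub (h k)).abs

theorem measurable_path (ω : Environment) : Measurable (path ω) := by
  classical
  refine Measurable.subtype_mk (f := fun ξ => (path ω ξ).1) (measurable_pi_lambda _ fun t => ?_)
  have hG : MeasurableSet {ξ : ℕ → ℤ | Tendsto (collisionTime ω ξ) atTop atTop} := by
    have : {ξ : ℕ → ℤ | Tendsto (collisionTime ω ξ) atTop atTop} =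
        ⋂ b : ℕ, ⋃ n : ℕ, {ξ | (b : ℝ) < collisionTime ω ξ n} := by
      ext ξ
      simp only [Set.mem_ofPred_eq, Set.mem_iInter, Set.mem_iUnion]
      refine ⟨fun h b => (h.eventually_gt_atTop (b : ℝ)).exists, fun h => ?_⟩
      refine tendsto_atTop_atTop_of_monotone (collisionTime_mono ω ξ) fun b => ?_
      obtain ⟨N, hN⟩ := exists_nat_ge b
      obtain ⟨n, hn⟩ := h N
      exact ⟨n, hN.trans hn.le⟩
    rw [this]
    exact MeasurableSet.iInter fun b => MeasurableSet.iUnion fun n =>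
      measurableSet_lt measurable_const (measurable_collisionTime ω n)
  have hpos : ∀ n, Measurable fun ξ : ℕ → ℤ =>
      ω.1 (walk ξ n) + (SignType.sign (ξ n) : ℝ) * (t - collisionTime ω ξ n) := fun n => by
    have h1 : Measurable fun ξ : ℕ → ℤ => ω.1 (walk ξ n) :=
      (measurable_from_top (f := ω.1)).comp (measurable_walk n)
    have h2 : Measurable fun ξ : ℕ → ℤ => (SignType.sign (ξ n) : ℝ) :=
      (measurable_from_top (f := fun k : ℤ => (SignType.sign k : ℝ))).comp (measurable_pi_apply n)
    exact h1.add (h2.mul (measurable_const.sub (measurable_collisionTime ω n)))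
  intro B hB
  have : (fun ξ => (path ω ξ).1 t) ⁻¹' B =
      ({ξ | Tendsto (collisionTime ω ξ) atTop atTop} ∩
        ⋃ n : ℕ, ({ξ | collisionTime ω ξ n ≤ t} ∩ {ξ | (t : ℝ) < collisionTime ω ξ (n + 1)}) ∩
          (fun ξ : ℕ → ℤ => ω.1 (walk ξ n) +
            (SignType.sign (ξ n) : ℝ) * (t - collisionTime ω ξ n)) ⁻¹' B) ∪
      ({ξ | Tendsto (collisionTime ω ξ) atTop atTop}ᶜ ∩ {_ξ | (0 : ℝ) ∈ B}) := by
    ext ξ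
    by_cases h : Tendsto (collisionTime ω ξ) atTop atTop
    · obtain ⟨n, h1, h2⟩ := exists_collision ω ξ h t
      simp only [Set.mem_preimage, path, h, dif_pos, Set.mem_union, Set.mem_inter_iff,
        Set.mem_ofPred_eq, Set.mem_iUnion, Set.mem_compl_iff, not_true_eq_false, false_and,
        or_false, true_and]
      constructor
      · intro hB
        exact ⟨n, ⟨h1, h2⟩, by rwa [← position_eq ω ξ n t h1 h2]⟩
      · rintro ⟨m, ⟨h3, h4⟩, hm⟩
        rwa [position_eq ω ξ m t h3 h4]
    · simp [path, h]
  rw [this]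
  refine (hG.inter (MeasurableSet.iUnion fun n => ?_)).union (hG.compl.inter (.const _))
  exact ((measurableSet_le (measurable_collisionTime ω n) measurable_const).inter
    (measurableSet_lt measurable_const (measurable_collisionTime ω (n + 1)))).inter (hpos n hB)

/-- The quenched law: the law on path space of the trajectory of the particle in the fixed
environment `ω`. -/
def quenchedLaw (p : PMF ℤ) (ω : Environment) : Measure PathSpace :=
  (jumpLaw p).map (path ω)

instance (p : PMF ℤ) (ω : Environment) : IsProbabilityMeasure (quenchedLaw p ω) :=
  Measure.isProbabilityMeasure_map (measurable_path ω).aemeasurable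

end LevyWalk

end

namespace LevyWalk

/-! ### Jumps of the underlying walk -/

/-! By the strong law for the gaps, `ω k ≈ μ k` in almost every environment. If also `τ n / n → c =
m̄ μ` for almost every walk, then about `t / c` collisions occur before time `t`, so `X t ≈ μ
S_{t/c}`, and the central limit theorem for the walk gives the variance `μ² v_p / c = (μ / m̄) v_p`.

The core is the law of large numbers for `τ n`, proved under the product of the jump and gap laws
and passed to almost every environment by Fubini. The time `τ n` sums the gaps over all crossings of
all steps. Replace the gap length by a bounded centred weight: the mean square is then the variance
of the weight times the expected number of pairs of steps crossing a common gap. A sum of `d` jumps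
hits any given integer with probability `O(d ^ (-1/2))`, so this number is `O(n ^ (3/2))`
(`exists_lintegral_sum_overlap_le`), which gives convergence along `n = k ^ 4`; monotonicity fills
in the other times. Gaps have only a first moment, so they are truncated; the remainder is
controlled for all `n` at once by the maximal ergodic inequality for the environment seen from the
particle (`ae_tendsto_weightedLength_div`).

The number of collisions depends on the walk. It is confined to a short deterministic window around
`t / c`, on which Kolmogorov's inequality bounds the oscillation of the walk
(`tendsto_measure_le_abs_path_sub`); Slutsky's lemma concludes. -/

theorem integrable_toMeasure_of_summable (p : PMF ℤ) (f : ℤ → ℝ)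
    (h : Summable fun k => |f k| * (p k).toReal) : Integrable f p.toMeasure := by
  refine ⟨measurable_from_top.aestronglyMeasurable, ?_⟩
  rw [hasFiniteIntegral_iff_enorm, lintegral_countable']
  have : ∀ k, ‖f k‖ₑ * p.toMeasure {k} = ENNReal.ofReal (|f k| * (p k).toReal) := fun k => by
    rw [PMF.toMeasure_apply_singleton p k (MeasurableSet.singleton k),
      ENNReal.ofReal_mul (abs_nonneg _), ENNReal.ofReal_toReal (p.apply_ne_top k),
      ← Real.norm_eq_abs, ofReal_norm]
  simp_rw [this]
  rw [← ENNReal.ofReal_tsum_of_nonneg (fun k => by positivity) h]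
  exact ENNReal.ofReal_lt_top

theorem measurePreserving_jump (p : PMF ℤ) (i : ℕ) :
    MeasurePreserving (fun ξ : ℕ → ℤ => ξ i) (jumpLaw p) p.toMeasure :=
  measurePreserving_eval_infinitePi _ i

theorem iIndepFun_jump (p : PMF ℤ) : iIndepFun (fun (i : ℕ) (ξ : ℕ → ℤ) => ξ i) (jumpLaw p) :=
  iIndepFun_infinitePi (X := fun _ k => k) fun _ => measurable_id

theorem iIndepFun_comp_jump (p : PMF ℤ) (f : ℤ → ℝ) :
    iIndepFun (fun (i : ℕ) (ξ : ℕ → ℤ) => f (ξ i)) (jumpLaw p) :=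
  (iIndepFun_jump p).comp (fun _ => f) fun _ => measurable_from_top

theorem identDistrib_comp_jump (p : PMF ℤ) (f : ℤ → ℝ) (i j : ℕ) :
    IdentDistrib (fun ξ : ℕ → ℤ => f (ξ i)) (fun ξ => f (ξ j)) (jumpLaw p) (jumpLaw p) where
  aemeasurable_fst := (measurable_from_top.comp (measurable_pi_apply i)).aemeasurable
  aemeasurable_snd := (measurable_from_top.comp (measurable_pi_apply j)).aemeasurable
  map_eq := by
    have h : ∀ i : ℕ, (jumpLaw p).map (fun ξ : ℕ → ℤ => f (ξ i)) = p.toMeasure.map f := fun i => by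
      rw [← (measurePreserving_jump p i).map_eq,
        Measure.map_map measurable_from_top (measurable_pi_apply i)]
      rfl
    rw [h, h]

theorem integral_comp_jump (p : PMF ℤ) (f : ℤ → ℝ) (i : ℕ) :
    ∫ ξ, f (ξ i) ∂jumpLaw p = ∫ k, f k ∂p.toMeasure := by
  rw [← (measurePreserving_jump p i).map_eq,
    integral_map (measurable_pi_apply i).aemeasurable measurable_from_top.aestronglyMeasurable]

theorem measurePreserving_shift (p : PMF ℤ) (m : ℕ) :
    MeasurePreserving (fun (ξ : ℕ → ℤ) i => ξ (i + m)) (jumpLaw p) (jumpLaw p) :=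
  ⟨by fun_prop, Measure.map_infinitePi_infinitePi_of_inj (P := fun _ : ℕ => p.toMeasure)
    (add_left_injective m)⟩

theorem walk_shift (ξ : ℕ → ℤ) (m k : ℕ) :
    walk (fun i => ξ (i + m)) k = walk ξ (m + k) - walk ξ m := by
  simp [walk, Finset.sum_range_add, add_comm]

theorem walk_succ (ξ : ℕ → ℤ) (n : ℕ) : walk ξ (n + 1) = walk ξ n + ξ n := by
  simp [walk, Finset.sum_range_succ]

/-! ### Second moments of the walk: variance, central limit theorem, maximal inequality. -/

section Moments

variable {p : PMF ℤ} (hsummable : Summable fun k : ℤ => (k : ℝ) ^ 2 * (p k).toReal)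

include hsummable

theorem memLp_two_intCast : MemLp (fun k : ℤ => (k : ℝ)) 2 p.toMeasure := by
  rw [memLp_two_iff_integrable_sq measurable_from_top.aestronglyMeasurable]
  exact integrable_toMeasure_of_summable p _ (by simpa using hsummable)

theorem integrable_intCast : Integrable (fun k : ℤ => (k : ℝ)) p.toMeasure :=
  (memLp_two_intCast hsummable).integrable (by norm_num)

theorem integral_abs_intCast : ∫ k : ℤ, |(k : ℝ)| ∂p.toMeasure = meanAbsJump p := by
  rw [PMF.integral_eq_tsum p _ (integrable_intCast hsummable).abs, meanAbsJump]
  simp [mul_comm]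

theorem integral_sq_intCast : ∫ k : ℤ, (k : ℝ) ^ 2 ∂p.toMeasure = jumpVariance p := by
  rw [PMF.integral_eq_tsum p _ (memLp_two_intCast hsummable).integrable_sq, jumpVariance]
  simp [mul_comm]

theorem memLp_two_jump (i : ℕ) : MemLp (fun ξ : ℕ → ℤ => (ξ i : ℝ)) 2 (jumpLaw p) :=
  (memLp_two_intCast hsummable).comp_measurePreserving (measurePreserving_jump p i)

theorem memLp_two_walk (n : ℕ) : MemLp (fun ξ : ℕ → ℤ => (walk ξ n : ℝ)) 2 (jumpLaw p) := by
  simp only [walk, Int.cast_sum]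
  exact memLp_finsetSum _ fun i _ => memLp_two_jump hsummable i

theorem meanAbsJump_pos (hpos : 0 < jumpVariance p) : 0 < meanAbsJump p := by
  rw [← integral_abs_intCast hsummable, integral_pos_iff_support_of_nonneg
    (fun k => abs_nonneg _) (integrable_intCast hsummable).abs]
  rw [← integral_sq_intCast hsummable, integral_pos_iff_support_of_nonneg
    (fun k => sq_nonneg _) (memLp_two_intCast hsummable).integrable_sq] at hpos
  -- Both integrands have the same support, the nonzero integers.
  convert! hpos using 2
  ext k
  simp

variable (hsymm : ∀ k : ℤ, p (-k) = p k)
include hsymm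

omit hsummable in
theorem integral_intCast_eq_zero : ∫ k : ℤ, (k : ℝ) ∂p.toMeasure = 0 := by
  have hmap : p.toMeasure.map (fun k : ℤ => -k) = p.toMeasure := by
    refine Measure.ext_of_singleton fun k => ?_
    rw [Measure.map_apply measurable_neg (MeasurableSet.singleton k)]
    have : (fun k : ℤ => -k) ⁻¹' {k} = {-k} := by ext; simp
    rw [this, PMF.toMeasure_apply_singleton p _ (MeasurableSet.singleton _),
      PMF.toMeasure_apply_singleton p _ (MeasurableSet.singleton _), hsymm]
  have h := integral_map (μ := p.toMeasure) (φ := fun k : ℤ => -k) measurable_neg.aemeasurable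
    (f := fun k : ℤ => (k : ℝ)) measurable_from_top.aestronglyMeasurable
  rw [hmap] at h
  simp only [Int.cast_neg, integral_neg] at h
  linarith

theorem variance_jump (i : ℕ) :
    Var[fun ξ : ℕ → ℤ => (ξ i : ℝ); jumpLaw p] = jumpVariance p := by
  rw [variance_of_integral_eq_zero (memLp_two_jump hsummable i).aemeasurable]
  · rw [integral_comp_jump p (fun k => (k : ℝ) ^ 2) i, integral_sq_intCast hsummable]
  · rw [integral_comp_jump p (fun k => (k : ℝ)) i, integral_intCast_eq_zero hsymm]

theorem integral_walk_sq (n : ℕ) :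
    ∫ ξ, (walk ξ n : ℝ) ^ 2 ∂jumpLaw p = n * jumpVariance p := by
  have h := IndepFun.variance_sum (μ := jumpLaw p) (X := fun i (ξ : ℕ → ℤ) => (ξ i : ℝ))
    (s := Finset.range n) (fun i _ => memLp_two_jump hsummable i)
    (fun i _ j _ hij => (iIndepFun_comp_jump p (fun k => (k : ℝ))).indepFun hij)
  simp only [variance_jump hsummable hsymm, Finset.sum_const, Finset.card_range,
    nsmul_eq_mul] at h
  have hS : (∑ i ∈ Finset.range n, fun ξ : ℕ → ℤ => (ξ i : ℝ)) = fun ξ => (walk ξ n : ℝ) := by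
    ext ξ; simp [walk]
  rw [hS, variance_of_integral_eq_zero (memLp_two_walk hsummable n).aemeasurable] at h
  · exact h
  · simp only [walk, Int.cast_sum]
    rw [integral_finsetSum _ fun i _ => (memLp_two_jump hsummable i).integrable (by norm_num)]
    refine Finset.sum_eq_zero fun i _ => ?_
    rw [integral_comp_jump p (fun k => (k : ℝ)) i, integral_intCast_eq_zero hsymm]

theorem tendsto_integral_walk_sq_div :
    Tendsto (fun n : ℕ => (∫ ξ, |(walk ξ n : ℝ)| ^ 2 ∂jumpLaw p) / (n : ℝ)) atTop
      (𝓝 (jumpVariance p)) := by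
  refine tendsto_const_nhds.congr' ?_
  filter_upwards [eventually_gt_atTop 0] with n hn
  have : (n : ℝ) ≠ 0 := by positivity
  simp only [sq_abs, integral_walk_sq hsummable hsymm]
  field_simp

/-- The central limit theorem for the underlying walk. -/
theorem tendstoInDistribution_walk :
    TendstoInDistribution (fun (n : ℕ) (ξ : ℕ → ℤ) => (√n)⁻¹ * (walk ξ n : ℝ)) atTop
      (fun z : ℝ => z) (fun _ => jumpLaw p) (gaussianReal 0 (jumpVariance p).toNNReal) := by
  have h := tendstoInDistribution_inv_sqrt_mul_sum_sub (P := jumpLaw p)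
    (X := fun i (ξ : ℕ → ℤ) => (ξ i : ℝ)) (Y := fun z : ℝ => z)
    (P' := gaussianReal 0 (jumpVariance p).toNNReal)
    (by rw [variance_jump hsummable hsymm]; exact HasLaw.id)
    (memLp_two_jump hsummable 0) (iIndepFun_comp_jump p (fun k => (k : ℝ)))
    (fun i => identDistrib_comp_jump p (fun k => (k : ℝ)) i 0)
  simpa [integral_comp_jump p (fun k => (k : ℝ)) 0, integral_intCast_eq_zero hsymm, walk]
    using h

/-- The natural filtration at time `n` already contains `ξ n`, hence the shift to `walk ξ (n + 1)`.
On an event of the past the cross term of the squared increment integrates to zero, because the next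
jump is centred and independent of the past; the remaining square is nonnegative. -/
theorem submartingale_walk_sq :
    Submartingale (fun n (ξ : ℕ → ℤ) => (walk ξ (n + 1) : ℝ) ^ 2)
      (Filtration.natural (fun i (ξ : ℕ → ℤ) => (ξ i : ℝ)) fun i =>
        (measurable_from_top.comp (measurable_pi_apply i)).stronglyMeasurable) (jumpLaw p) := by
  have hsm : ∀ i, StronglyMeasurable fun ξ : ℕ → ℤ => (ξ i : ℝ) := fun i =>
    (measurable_from_top.comp (measurable_pi_apply i)).stronglyMeasurable
  have hadapt : ∀ n, Measurable[Filtration.natural (fun i (ξ : ℕ → ℤ) => (ξ i : ℝ)) hsm n]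
      fun ξ : ℕ → ℤ => (walk ξ (n + 1) : ℝ) := fun n => by
    simp only [walk, Int.cast_sum]
    refine Finset.measurable_sum _ fun i hi => ?_
    have h1 : Measurable[Filtration.natural (fun i (ξ : ℕ → ℤ) => (ξ i : ℝ)) hsm i]
      fun ξ : ℕ → ℤ => (ξ i : ℝ) := (Filtration.stronglyAdapted_natural hsm i).measurable
    exact h1.mono ((Filtration.natural _ hsm).mono (by simpa [Nat.lt_succ_iff] using hi)) le_rfl
  have hint : ∀ n, Integrable (fun ξ : ℕ → ℤ => (walk ξ n : ℝ) ^ 2) (jumpLaw p) := fun n =>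
    (memLp_two_walk hsummable n).integrable_sq
  refine submartingale_of_setIntegral_le_succ
    (fun n => ((hadapt n).pow_const 2).stronglyMeasurable) (fun n => hint (n + 1)) ?_
  intro n s hs
  have hs' : MeasurableSet s := (Filtration.natural _ hsm).le n s hs
  have hindep : IndepFun (s.indicator fun ξ : ℕ → ℤ => (walk ξ (n + 1) : ℝ))
      (fun ξ => (ξ (n + 1) : ℝ)) (jumpLaw p) := by
    have h := (iIndepFun_comp_jump p (fun k => (k : ℝ))).indep_comap_natural_of_lt hsm
      (Nat.lt_succ_self n)
    refine (indep_of_indep_of_le_right h ?_).symm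
    exact ((hadapt n).indicator hs).comap_le
  have hw1 : Integrable (fun ξ : ℕ → ℤ => (walk ξ (n + 1) : ℝ)) (jumpLaw p) :=
    (memLp_two_walk hsummable (n + 1)).integrable (by norm_num)
  have hx1 : Integrable (fun ξ : ℕ → ℤ => (ξ (n + 1) : ℝ)) (jumpLaw p) :=
    (memLp_two_jump hsummable (n + 1)).integrable (by norm_num)
  have hcross : ∫ ξ in s, (walk ξ (n + 1) : ℝ) * (ξ (n + 1) : ℝ) ∂jumpLaw p = 0 := by
    rw [← integral_indicator hs']
    have : (s.indicator fun ξ : ℕ → ℤ => (walk ξ (n + 1) : ℝ) * (ξ (n + 1) : ℝ)) =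
        fun ξ => (s.indicator fun ξ : ℕ → ℤ => (walk ξ (n + 1) : ℝ)) ξ * (ξ (n + 1) : ℝ) := by
      ext ξ; by_cases h : ξ ∈ s <;> simp [h]
    rw [this, hindep.integral_fun_mul_eq_mul_integral
      (hw1.indicator hs').aestronglyMeasurable hx1.aestronglyMeasurable,
      integral_comp_jump p (fun k => (k : ℝ)), integral_intCast_eq_zero hsymm, mul_zero]
  have hsq : Integrable (fun ξ : ℕ → ℤ => (ξ (n + 1) : ℝ) ^ 2) (jumpLaw p) :=
    (memLp_two_jump hsummable (n + 1)).integrable_sq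
  have hprod : Integrable (fun ξ : ℕ → ℤ => (walk ξ (n + 1) : ℝ) * (ξ (n + 1) : ℝ))
      (jumpLaw p) :=
    (memLp_two_walk hsummable (n + 1)).integrable_mul (memLp_two_jump hsummable (n + 1))
  have hexp : ∀ ξ : ℕ → ℤ, (walk ξ (n + 1 + 1) : ℝ) ^ 2 = (walk ξ (n + 1) : ℝ) ^ 2 +
      2 * ((walk ξ (n + 1) : ℝ) * (ξ (n + 1) : ℝ)) + (ξ (n + 1) : ℝ) ^ 2 := fun ξ => by
    rw [walk_succ ξ (n + 1)]; push_cast; ring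
  simp only [hexp]
  have hsum : Integrable (fun ξ : ℕ → ℤ => (walk ξ (n + 1) : ℝ) ^ 2 +
      2 * ((walk ξ (n + 1) : ℝ) * (ξ (n + 1) : ℝ))) (jumpLaw p) :=
    (hint _).add (hprod.const_mul 2)
  rw [integral_add hsum.integrableOn hsq.integrableOn, integral_add (hint _).integrableOn (hprod.const_mul 2).integrableOn,
    integral_const_mul, hcross]
  have : 0 ≤ ∫ ξ in s, (ξ (n + 1) : ℝ) ^ 2 ∂jumpLaw p := integral_nonneg fun _ => sq_nonneg _
  linarith

/-- Kolmogorov's maximal inequality for the underlying walk. -/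
theorem measure_exists_le_abs_walk (n : ℕ) {a : ℝ} (ha : 0 < a) :
    jumpLaw p {ξ | ∃ k ≤ n, a ≤ |(walk ξ k : ℝ)|} ≤
      ENNReal.ofReal (n * jumpVariance p / a ^ 2) := by
  -- The submartingale starts at `walk ξ 1`, so the horizon `0` is treated apart.
  rcases n with _ | n
  · have : {ξ : ℕ → ℤ | ∃ k ≤ 0, a ≤ |(walk ξ k : ℝ)|} = ∅ := by
      ext ξ; simp [walk, ha]
    rw [this]; simp
  obtain ⟨ε, hε⟩ : ∃ ε : ℝ≥0, (ε : ℝ) = a ^ 2 := ⟨⟨a ^ 2, sq_nonneg a⟩, rfl⟩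
  have h := maximal_ineq (submartingale_walk_sq hsummable hsymm)
    (fun _ _ => sq_nonneg _) (ε := ε) n
  have hsub : {ξ : ℕ → ℤ | ∃ k ≤ n + 1, a ≤ |(walk ξ k : ℝ)|} ⊆
      {ξ | (ε : ℝ) ≤ (Finset.range (n + 1)).sup'
        Finset.nonempty_range_add_one fun k => (walk ξ (k + 1) : ℝ) ^ 2} := by
    rintro ξ ⟨k, hk, hak⟩
    rcases k with _ | k
    · simp [walk] at hak; linarith
    · simp only [Set.mem_ofPred_eq, Finset.le_sup'_iff]
      refine ⟨k, by simpa using hk, ?_⟩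
      rw [hε, ← sq_abs (walk ξ (k + 1) : ℝ)]
      exact pow_le_pow_left₀ ha.le hak 2
  have hint : ∫ ξ in {ξ | (ε : ℝ) ≤ (Finset.range (n + 1)).sup'
        Finset.nonempty_range_add_one fun k => (walk ξ (k + 1) : ℝ) ^ 2},
        (walk ξ (n + 1) : ℝ) ^ 2 ∂jumpLaw p ≤ (n + 1 : ℕ) * jumpVariance p := by
    rw [← integral_walk_sq hsummable hsymm]
    exact setIntegral_le_integral (memLp_two_walk hsummable _).integrable_sq
      (ae_of_all _ fun _ => sq_nonneg _)
  rw [ENNReal.ofReal_div_of_pos (by positivity)]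
  rw [ENNReal.le_div_iff_mul_le (by left; simp; positivity) (by left; simp), mul_comm, ← hε, ENNReal.ofReal_coe_nnreal]
  exact (mul_le_mul_right (measure_mono hsub) _).trans (h.trans (ENNReal.ofReal_le_ofReal hint))

/-- Dropping the first `m` jumps preserves `jumpLaw p`, which reduces the claim to `m = 0`. -/
theorem measure_exists_le_abs_walk_sub (m n : ℕ) {a : ℝ} (ha : 0 < a) :
    jumpLaw p {ξ | ∃ k ≤ n, a ≤ |(walk ξ (m + k) : ℝ) - walk ξ m|} ≤
      ENNReal.ofReal (n * jumpVariance p / a ^ 2) := by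
  refine le_trans (le_of_eq ?_) (measure_exists_le_abs_walk hsummable hsymm n ha)
  have hmeas : MeasurableSet {ξ : ℕ → ℤ | ∃ k ≤ n, a ≤ |(walk ξ k : ℝ)|} := by
    have : {ξ : ℕ → ℤ | ∃ k ≤ n, a ≤ |(walk ξ k : ℝ)|} =
        ⋃ k, ⋃ (_ : k ≤ n), {ξ | a ≤ |(walk ξ k : ℝ)|} := by ext; simp
    rw [this]
    exact .iUnion fun k => .iUnion fun _ => measurableSet_le measurable_const
      (measurable_from_top (f := fun k : ℤ => |(k : ℝ)|) |>.comp (measurable_walk k))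
  rw [← (measurePreserving_shift p m).measure_preimage hmeas.nullMeasurableSet]
  congr 1
  ext ξ
  simp [walk_shift]

end Moments

/-! ### Concentration of sums of jumps -/

/-- If `p 1` vanished, monotonicity and symmetry would put all mass at `0`, and the variance would
be zero. This is the only use of monotonicity: the concentration estimate needs just the atoms at
`±1`. -/
theorem apply_one_pos {p : PMF ℤ} (hsymm : ∀ k : ℤ, p (-k) = p k)
    (hmono : ∀ k : ℤ, 1 ≤ k → p (k + 1) ≤ p k) (hpos : 0 < jumpVariance p) :
    0 < (p 1).toReal := by
  by_contra hcon
  have h1 : p 1 = 0 := by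
    have h0 : (p 1).toReal = 0 := le_antisymm (not_lt.1 hcon) ENNReal.toReal_nonneg
    simpa [ENNReal.toReal_eq_zero_iff, p.apply_ne_top] using h0
  have hge : ∀ k : ℤ, 1 ≤ k → p k = 0 := fun k hk => by
    induction k, hk using Int.leInduction with
    | base => exact h1
    | succ k hk ih => exact le_antisymm ((hmono k hk).trans ih.le) zero_le
  have hne : ∀ k : ℤ, k ≠ 0 → p k = 0 := fun k hk => by
    rcases lt_or_gt_of_ne hk with h | h
    · rw [← hsymm]; exact hge _ (by omega)
    · exact hge _ (by omega)
  have : jumpVariance p = 0 := by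
    unfold jumpVariance
    convert! tsum_zero with k
    rcases eq_or_ne k 0 with rfl | hk
    · simp
    · simp [hne k hk]
  exact hpos.ne' this

/-- Fourier orthogonality; it expresses the probability of hitting an integer as an integral over
frequencies. -/
theorem integral_cos_int_mul (m : ℤ) :
    ∫ θ in -Real.pi..Real.pi, Real.cos (m * θ) = if m = 0 then 2 * Real.pi else 0 := by
  split_ifs with hm
  · subst hm; simp; ring
  · have hm' : (m : ℝ) ≠ 0 := by exact_mod_cast hm
    rw [intervalIntegral.integral_comp_mul_left (fun x => Real.cos x) hm', integral_cos]
    simp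

/-- With `q` the mass of each of the atoms `±1`, these contribute `2 q cos θ` and the rest at most
`1 - 2 q`. The bound `1 - 2 q (1 - |cos θ|) ≤ 1 - q sin² θ` follows from `sin² θ = (1 - |cos θ|) (1
+ |cos θ|)`. -/
theorem norm_charFun_le {p : PMF ℤ} (hsymm : ∀ k : ℤ, p (-k) = p k) (θ : ℝ) :
    ‖charFun (p.toMeasure.map fun k : ℤ => (k : ℝ)) θ‖ ≤
      Real.exp (-((p 1).toReal * Real.sin θ ^ 2)) := by
  set q := (p 1).toReal with hq
  have hq0 : 0 ≤ q := ENNReal.toReal_nonneg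
  have hmeas : ∀ k, p.toMeasure.real {k} = (p k).toReal := fun k => by
    rw [measureReal_def, PMF.toMeasure_apply_singleton p k (MeasurableSet.singleton k)]
  have hA : p.toMeasure.real {1, -1} = 2 * q := by
    rw [show ({1, -1} : Set ℤ) = {1} ∪ {-1} from rfl,
      measureReal_union (by simp) (MeasurableSet.singleton _), hmeas, hmeas, hsymm]
    ring
  have hint : Integrable (fun k : ℤ => Complex.exp (θ * (k : ℝ) * Complex.I)) p.toMeasure := by
    refine Integrable.of_bound measurable_from_top.aestronglyMeasurable 1 (ae_of_all _ fun k => ?_)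
    rw [← Complex.ofReal_mul, Complex.norm_exp_ofReal_mul_I]
  rw [charFun_apply_real, integral_map measurable_from_top.aemeasurable
    (by fun_prop), ← integral_add_compl (s := {1, -1}) (by measurability) hint]
  have h1 : ∫ k in ({1, -1} : Set ℤ), Complex.exp (θ * (k : ℝ) * Complex.I) ∂p.toMeasure =
      ((2 * q * Real.cos θ : ℝ) : ℂ) := by
    rw [show ({1, -1} : Set ℤ) = ({1, -1} : Finset ℤ) by simp, setIntegral_finset _
      (by simpa only [Finset.coe_insert, Finset.coe_singleton] using hint.integrableOn)]
    rw [Finset.sum_pair (by norm_num)]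
    rw [hmeas, hmeas, hsymm, ← hq]
    push_cast
    rw [Complex.cos]
    simp
    ring_nf
  have h2 : ‖∫ k in ({1, -1} : Set ℤ)ᶜ, Complex.exp (θ * (k : ℝ) * Complex.I) ∂p.toMeasure‖ ≤
      1 - 2 * q := by
    refine (norm_setIntegral_le_of_norm_le_const (C := 1) (measure_lt_top _ _)
      fun k _ => ?_).trans ?_
    · rw [← Complex.ofReal_mul, Complex.norm_exp_ofReal_mul_I]
    · rw [probReal_compl_eq_one_sub (by measurability), hA, one_mul]
  rw [h1]
  refine (norm_add_le _ _).trans ?_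
  rw [Complex.norm_real, Real.norm_eq_abs, abs_mul, abs_of_nonneg (by positivity : 0 ≤ 2 * q)]
  have h3 : Real.sin θ ^ 2 ≤ 2 * (1 - |Real.cos θ|) := by
    rw [Real.sin_sq, ← sq_abs (Real.cos θ)]
    nlinarith [abs_nonneg (Real.cos θ), Real.abs_cos_le_one θ]
  have h4 := Real.add_one_le_exp (-(q * Real.sin θ ^ 2))
  nlinarith

/-- The sine vanishes at `0` and `±π`, and every `θ` of the interval is within `π / 2` of one of
these points. Jordan's inequality `|sin x| ≥ 2 |x| / π` there gives the Gaussian centred at that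
point. -/
theorem exp_neg_mul_sin_sq_le {b θ : ℝ} (hb : 0 ≤ b) (hθ : θ ∈ Set.Ioc (-Real.pi) Real.pi) :
    Real.exp (-(b * Real.sin θ ^ 2)) ≤ Real.exp (-(b * (2 / Real.pi) ^ 2) * θ ^ 2) +
      (Real.exp (-(b * (2 / Real.pi) ^ 2) * (θ - Real.pi) ^ 2) +
        Real.exp (-(b * (2 / Real.pi) ^ 2) * (θ + Real.pi) ^ 2)) := by
  have key : ∀ x : ℝ, |x| ≤ Real.pi / 2 → Real.sin x ^ 2 = Real.sin θ ^ 2 →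
      Real.exp (-(b * Real.sin θ ^ 2)) ≤ Real.exp (-(b * (2 / Real.pi) ^ 2) * x ^ 2) := by
    intro x hx hs
    rw [← hs, Real.exp_le_exp, neg_mul, neg_le_neg_iff, mul_assoc]
    refine mul_le_mul_of_nonneg_left ?_ hb
    rw [← mul_pow, ← sq_abs (Real.sin x), ← sq_abs (2 / Real.pi * x), abs_mul,
      abs_of_pos (by positivity : 0 < 2 / Real.pi)]
    exact pow_le_pow_left₀ (by positivity) (Real.mul_abs_le_abs_sin hx) 2
  have p1 := Real.exp_pos (-(b * (2 / Real.pi) ^ 2) * θ ^ 2)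
  have p2 := Real.exp_pos (-(b * (2 / Real.pi) ^ 2) * (θ - Real.pi) ^ 2)
  have p3 := Real.exp_pos (-(b * (2 / Real.pi) ^ 2) * (θ + Real.pi) ^ 2)
  rcases le_or_gt |θ| (Real.pi / 2) with h | h
  · linarith [key θ h rfl]
  · rcases lt_abs.1 h with h | h
    · have := key (θ - Real.pi) (abs_le.2 ⟨by linarith, by linarith [hθ.2, Real.pi_pos]⟩)
        (by rw [Real.sin_sub_pi]; ring)
      linarith
    · have := key (θ + Real.pi) (abs_le.2 ⟨by linarith [hθ.1, Real.pi_pos], by linarith⟩)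
        (by rw [Real.sin_add_pi]; ring)
      linarith

theorem setIntegral_exp_neg_mul_sin_sq_le {b : ℝ} (hb : 0 < b) :
    ∫ θ in Set.Ioc (-Real.pi) Real.pi, Real.exp (-(b * Real.sin θ ^ 2)) ≤
      3 * √(Real.pi / (b * (2 / Real.pi) ^ 2)) := by
  set c := b * (2 / Real.pi) ^ 2 with hc
  have hc0 : 0 < c := by positivity
  have i1 : Integrable fun θ : ℝ => Real.exp (-c * θ ^ 2) := integrable_exp_neg_mul_sq hc0
  have i2 : Integrable fun θ : ℝ => Real.exp (-c * (θ - Real.pi) ^ 2) :=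
    i1.comp_sub_right Real.pi
  have i3 : Integrable fun θ : ℝ => Real.exp (-c * (θ + Real.pi) ^ 2) :=
    i1.comp_add_right Real.pi
  have i23 : Integrable fun θ : ℝ => Real.exp (-c * (θ - Real.pi) ^ 2) +
    Real.exp (-c * (θ + Real.pi) ^ 2) := i2.add i3
  have i123 : Integrable fun θ : ℝ => Real.exp (-c * θ ^ 2) +
    (Real.exp (-c * (θ - Real.pi) ^ 2) + Real.exp (-c * (θ + Real.pi) ^ 2)) := i1.add i23
  calc ∫ θ in Set.Ioc (-Real.pi) Real.pi, Real.exp (-(b * Real.sin θ ^ 2))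
      ≤ ∫ θ in Set.Ioc (-Real.pi) Real.pi, (Real.exp (-c * θ ^ 2) +
        (Real.exp (-c * (θ - Real.pi) ^ 2) + Real.exp (-c * (θ + Real.pi) ^ 2))) := by
        refine setIntegral_mono_on ?_ i123.integrableOn measurableSet_Ioc
          fun θ hθ => exp_neg_mul_sin_sq_le hb.le hθ
        exact (Continuous.integrableOn_Icc (by fun_prop)).mono_set Set.Ioc_subset_Icc_self
    _ ≤ ∫ θ, (Real.exp (-c * θ ^ 2) +
        (Real.exp (-c * (θ - Real.pi) ^ 2) + Real.exp (-c * (θ + Real.pi) ^ 2))) :=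
        setIntegral_le_integral i123 (ae_of_all _ fun θ => by positivity)
    _ = 3 * √(Real.pi / c) := by
        rw [integral_add i1 i23, integral_add i2 i3,
          integral_sub_right_eq_self (fun θ => Real.exp (-c * θ ^ 2)),
          integral_add_right_eq_self (fun θ => Real.exp (-c * θ ^ 2)), integral_gaussian]
        ring

theorem charFun_sum_jump (p : PMF ℤ) (s : Finset ℕ) (θ : ℝ) :
    ∫ ξ, Complex.exp (θ * ((∑ l ∈ s, ξ l : ℤ) : ℝ) * Complex.I) ∂jumpLaw p =
      charFun (p.toMeasure.map fun k : ℤ => (k : ℝ)) θ ^ s.card := by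
  have hm : ∀ l : ℕ, Measurable fun ξ : ℕ → ℤ => (ξ l : ℝ) := fun l =>
    measurable_from_top.comp (measurable_pi_apply l)
  have h := congrFun (((iIndepFun_comp_jump p fun k => (k : ℝ)).restrict
    s).charFun_map_fun_finsetSum_eq_prod (fun l _ => (hm l).aemeasurable)) θ
  rw [charFun_apply_real, integral_map (Finset.measurable_sum s fun l _ => hm l).aemeasurable
    (by fun_prop)] at h
  push_cast at h ⊢
  rw [h, Finset.prod_apply, Finset.prod_congr rfl (g := fun _ =>
    charFun (p.toMeasure.map fun k : ℤ => (k : ℝ)) θ), Finset.prod_const]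
  intro l _
  rw [← (measurePreserving_jump p l).map_eq,
    Measure.map_map measurable_from_top (measurable_pi_apply l)]
  rfl

/-- Fourier inversion on the integers: `2π` times the indicator of `W = w` is the integral of `cos
((W - w) θ)`. After Fubini the integrand is the real part of a unimodular factor times a power of
the characteristic function. -/
theorem measureReal_sum_jump_eq_le {p : PMF ℤ} (hsymm : ∀ k : ℤ, p (-k) = p k) (s : Finset ℕ)
    (w : ℤ) :
    2 * Real.pi * (jumpLaw p).real {ξ | ∑ l ∈ s, ξ l = w} ≤
      ∫ θ in Set.Ioc (-Real.pi) Real.pi,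
        Real.exp (-(s.card * (p 1).toReal * Real.sin θ ^ 2)) := by
  have hW : Measurable fun ξ : ℕ → ℤ => ∑ l ∈ s, ξ l := by fun_prop
  have hWr : Measurable fun ξ : ℕ → ℤ => ((∑ l ∈ s, ξ l - w : ℤ) : ℝ) :=
    measurable_from_top.comp (hW.sub_const w)
  have hset : MeasurableSet {ξ : ℕ → ℤ | ∑ l ∈ s, ξ l = w} := hW (MeasurableSet.singleton w)
  have e1 : 2 * Real.pi * (jumpLaw p).real {ξ | ∑ l ∈ s, ξ l = w} =
      ∫ ξ, (∫ θ in Set.Ioc (-Real.pi) Real.pi,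
        Real.cos (((∑ l ∈ s, ξ l - w : ℤ) : ℝ) * θ)) ∂jumpLaw p := by
    have : ∀ ξ : ℕ → ℤ, ∫ θ in Set.Ioc (-Real.pi) Real.pi,
        Real.cos (((∑ l ∈ s, ξ l - w : ℤ) : ℝ) * θ) =
        {ξ : ℕ → ℤ | ∑ l ∈ s, ξ l = w}.indicator (fun _ => 2 * Real.pi) ξ := fun ξ => by
      rw [← intervalIntegral.integral_of_le (by linarith [Real.pi_pos]), integral_cos_int_mul]
      simp [Set.indicator_apply, sub_eq_zero]
    simp_rw [this]
    rw [integral_indicator_const _ hset, smul_eq_mul, mul_comm]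
  have : IsFiniteMeasure (volume.restrict (Set.Ioc (-Real.pi) Real.pi)) :=
    ⟨by simp⟩
  rw [e1, integral_integral_swap]
  · refine setIntegral_mono_on ?_ ?_ measurableSet_Ioc fun θ _ => ?_
    · refine Integrable.integral_prod_left (f := fun z : ℝ × (ℕ → ℤ) =>
        Real.cos (((∑ l ∈ s, z.2 l - w : ℤ) : ℝ) * z.1)) ?_
      refine Integrable.of_bound ?_ 1 (ae_of_all _ fun z => Real.abs_cos_le_one _)
      exact (Real.measurable_cos.comp
        ((hWr.comp measurable_snd).mul measurable_fst)).aestronglyMeasurable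
    · exact (Continuous.integrableOn_Icc (by fun_prop)).mono_set Set.Ioc_subset_Icc_self
    · have hre : ∫ ξ, Real.cos (((∑ l ∈ s, ξ l - w : ℤ) : ℝ) * θ) ∂jumpLaw p =
          (Complex.exp (-(θ * w) * Complex.I) *
            ∫ ξ, Complex.exp (θ * ((∑ l ∈ s, ξ l : ℤ) : ℝ) * Complex.I) ∂jumpLaw p).re := by
        rw [← integral_const_mul]
        have hi : Integrable (fun ξ : ℕ → ℤ => Complex.exp (-(θ * w) * Complex.I) *
            Complex.exp (θ * ((∑ l ∈ s, ξ l : ℤ) : ℝ) * Complex.I)) (jumpLaw p) := by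
          refine Integrable.const_mul (Integrable.of_bound ?_ 1 (ae_of_all _ fun ξ => ?_)) _
          · exact (measurable_from_top (f := fun k : ℤ =>
              Complex.exp (θ * (k : ℝ) * Complex.I)) |>.comp hW).aestronglyMeasurable
          · rw [← Complex.ofReal_mul, Complex.norm_exp_ofReal_mul_I]
        rw [← RCLike.re_eq_complex_re, ← integral_re hi]
        refine integral_congr_ae (ae_of_all _ fun ξ => ?_)
        simp only [RCLike.re_eq_complex_re]
        rw [← Complex.exp_add, ← Complex.exp_ofReal_mul_I_re]
        congr 2
        push_cast
        ring
      rw [hre, charFun_sum_jump]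
      refine (Complex.re_le_norm _).trans ?_
      have h1 : ‖Complex.exp (-(θ * w) * Complex.I)‖ = 1 := by
        have := Complex.norm_exp_ofReal_mul_I (-(θ * w))
        push_cast at this
        exact this
      rw [norm_mul, h1, one_mul, norm_pow]
      refine (pow_le_pow_left₀ (norm_nonneg _) (norm_charFun_le hsymm θ) _).trans (le_of_eq ?_)
      rw [← Real.exp_nat_mul]
      congr 1
      ring
  · refine Integrable.of_bound ?_ 1 (ae_of_all _ fun z => Real.abs_cos_le_one _)
    exact (Real.measurable_cos.comp
        ((hWr.comp measurable_fst).mul measurable_snd)).aestronglyMeasurable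

/-- The sum of `n` jumps has concentration of order `n ^ (-1 / 2)`. -/
theorem exists_measure_sum_jump_eq_le {p : PMF ℤ} (hsymm : ∀ k : ℤ, p (-k) = p k)
    (h1 : 0 < (p 1).toReal) :
    ∃ K : ℝ, 0 < K ∧ ∀ (s : Finset ℕ) (w : ℤ),
      jumpLaw p {ξ | ∑ l ∈ s, ξ l = w} ≤ ENNReal.ofReal (K / √(s.card + 1)) := by
  set q := (p 1).toReal
  set D := 3 * √(Real.pi / (q * (2 / Real.pi) ^ 2)) with hD
  -- The `1` serves the empty sum; `D` comes from the Gaussian integrals, the loss `√(card + 1) ≤ 2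
  -- √card` being absorbed by `2π`.
  refine ⟨1 + D, by positivity, fun s w => ?_⟩
  rw [← ENNReal.ofReal_toReal (measure_ne_top (jumpLaw p) _)]
  refine ENNReal.ofReal_le_ofReal ?_
  rcases Nat.eq_zero_or_pos s.card with hs | hs
  · rw [hs]
    have : (jumpLaw p).real {ξ | ∑ l ∈ s, ξ l = w} ≤ 1 := measureReal_le_one
    have hD0 : 0 ≤ D := by positivity
    simp only [Nat.cast_zero, zero_add, Real.sqrt_one, div_one]
    exact this.trans (by linarith)
  · have hs' : (0 : ℝ) < s.card := by exact_mod_cast hs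
    have hs1 : (1 : ℝ) ≤ s.card := by exact_mod_cast hs
    have h := (measureReal_sum_jump_eq_le hsymm s w).trans
      (setIntegral_exp_neg_mul_sin_sq_le (b := s.card * q) (by positivity))
    have e : 3 * √(Real.pi / (s.card * q * (2 / Real.pi) ^ 2)) = D / √s.card := by
      rw [hD, mul_div_assoc, ← Real.sqrt_div (by positivity), div_div]
      congr 3
      ring
    rw [e] at h
    have hsq : √((s.card : ℝ) + 1) ≤ 2 * √s.card := by
      rw [Real.sqrt_le_left (by positivity), mul_pow, Real.sq_sqrt hs'.le]
      linarith
    have hpi : 2 ≤ 2 * Real.pi := by linarith [Real.pi_gt_three]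
    have hnn : 0 ≤ (jumpLaw p).real {ξ | ∑ l ∈ s, ξ l = w} := measureReal_nonneg
    change (jumpLaw p).real {ξ | ∑ l ∈ s, ξ l = w} ≤ _
    rw [le_div_iff₀ (by positivity)]
    rw [le_div_iff₀ (by positivity)] at h
    have hsq0 : 0 < √(s.card : ℝ) := by positivity
    calc (jumpLaw p).real {ξ | ∑ l ∈ s, ξ l = w} * √((s.card : ℝ) + 1)
        ≤ (jumpLaw p).real {ξ | ∑ l ∈ s, ξ l = w} * (2 * √s.card) := by gcongr
      _ = 2 * (jumpLaw p).real {ξ | ∑ l ∈ s, ξ l = w} * √s.card := by ring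
      _ ≤ 2 * Real.pi * (jumpLaw p).real {ξ | ∑ l ∈ s, ξ l = w} * √s.card := by gcongr
      _ ≤ 1 + D := by linarith

/-! ### Crossed gaps and their overlaps -/

/-- The indices of the gaps crossed when travelling between the targets `a` and `b`. -/
@[irreducible]
noncomputable def crossed (a b : ℤ) : Finset ℤ := Finset.Ioc (min a b) (max a b)

theorem card_crossed (a b : ℤ) : (crossed a b).card = (b - a).natAbs := by
  simp only [crossed, Int.card_Ioc]; omega

theorem add_mem_crossed (a b c j : ℤ) : j + c ∈ crossed (a + c) (b + c) ↔ j ∈ crossed a b := by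
  simp only [crossed, Finset.mem_Ioc]; omega

theorem abs_target_sub (ζ : Gaps) (a b : ℤ) :
    |target ζ b - target ζ a| = ∑ j ∈ crossed a b, (ζ j : ℝ) := by
  have key : ∀ a b : ℤ, a ≤ b → target ζ b - target ζ a = ∑ j ∈ Finset.Ioc a b, (ζ j : ℝ) := by
    intro a b hab
    induction b, hab using Int.leInduction with
    | base => simp
    | succ b hb ih =>
      have h1 : Finset.Ioc a (b + 1) = insert (b + 1) (Finset.Ioc a b) := by
        ext i; simp only [Finset.mem_Ioc, Finset.mem_insert]; omega
      rw [h1, Finset.sum_insert (by simp), ← ih, target_eq ζ (b + 1), add_sub_cancel_right]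
      ring
  rcases le_total a b with h | h
  · rw [abs_of_nonneg (sub_nonneg.2 ((target_strictMono ζ).monotone h)), key a b h, crossed,
      min_eq_left h, max_eq_right h]
  · rw [abs_sub_comm, abs_of_nonneg (sub_nonneg.2 ((target_strictMono ζ).monotone h)),
      key b a h, crossed, min_eq_right h, max_eq_left h]

/-- The number of gaps crossed both in the `i`-th and in the `k`-th step of the walk. -/
noncomputable def overlap (ξ : ℕ → ℤ) (i k : ℕ) : ℕ :=
  (crossed (walk ξ i) (walk ξ (i + 1)) ∩ crossed (walk ξ k) (walk ξ (k + 1))).card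

theorem overlap_comm (ξ : ℕ → ℤ) (i k : ℕ) : overlap ξ i k = overlap ξ k i := by
  rw [overlap, overlap, Finset.inter_comm]

theorem overlap_self (ξ : ℕ → ℤ) (i : ℕ) : overlap ξ i i = (ξ i).natAbs := by
  rw [overlap, Finset.inter_self, card_crossed, walk_succ, add_sub_cancel_left]

theorem card_crossed_inter_crossed_add (a b a' b' c : ℤ) :
    (crossed (a + c) (b + c) ∩ crossed (a' + c) (b' + c)).card =
      (crossed a b ∩ crossed a' b').card := by
  rw [← Finset.card_map (addRightEmbedding c) (s := crossed a b ∩ crossed a' b')]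
  congr 1
  ext j
  simp only [Finset.mem_inter, Finset.mem_map, addRightEmbedding_apply]
  constructor
  · rintro ⟨h1, h2⟩
    refine ⟨j - c, ⟨?_, ?_⟩, by ring⟩
    · rwa [← add_mem_crossed a b c, sub_add_cancel]
    · rwa [← add_mem_crossed a' b' c, sub_add_cancel]
  · rintro ⟨j, ⟨h1, h2⟩, rfl⟩
    exact ⟨(add_mem_crossed _ _ _ _).2 h1, (add_mem_crossed _ _ _ _).2 h2⟩

/-- Translating by `walk ξ (i + 1)` leaves only `ξ i`, `ξ k` and the sum of the jumps strictly
between them. That sum is independent of the pair, so its concentration can be used. -/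
theorem overlap_eq (ξ : ℕ → ℤ) {i k : ℕ} (hik : i < k) :
    overlap ξ i k = (crossed (-ξ i) 0 ∩ crossed (∑ l ∈ Finset.Ico (i + 1) k, ξ l)
      (∑ l ∈ Finset.Ico (i + 1) k, ξ l + ξ k)).card := by
  have h : walk ξ k = ∑ l ∈ Finset.Ico (i + 1) k, ξ l + walk ξ (i + 1) := by
    rw [walk, walk, add_comm, Finset.sum_range_add_sum_Ico _ (by omega)]
  rw [← card_crossed_inter_crossed_add (-ξ i) 0 _ _ (walk ξ (i + 1)), overlap, walk_succ ξ k, h,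
    zero_add, add_right_comm, show -ξ i + walk ξ (i + 1) = walk ξ i by rw [walk_succ]; ring]

/-- Double counting: each of the `|x|` gaps of the first set lies in exactly `|y|` translates of the
second. -/
theorem tsum_card_crossed_inter (x y : ℤ) :
    ∑' w : ℤ, ((crossed (-x) 0 ∩ crossed w (w + y)).card : ENNReal) =
      (x.natAbs : ENNReal) * y.natAbs := by
  have h1 : ∀ w : ℤ, ((crossed (-x) 0 ∩ crossed w (w + y)).card : ENNReal) =
      ∑ j ∈ crossed (-x) 0, if j ∈ crossed w (w + y) then 1 else 0 := fun w => by
    rw [Finset.sum_ite_mem]; simp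
  have h2 : ∀ j : ℤ, ∑' w : ℤ, (if j ∈ crossed w (w + y) then (1 : ENNReal) else 0) =
      y.natAbs := fun j => by
    rw [← (Equiv.subLeft j).tsum_eq]
    have h3 : ∀ w : ℤ, (if j ∈ crossed (Equiv.subLeft j w) (Equiv.subLeft j w + y) then
        (1 : ENNReal) else 0) = if w ∈ crossed 0 y then 1 else 0 := fun w => by
      have : j ∈ crossed (j - w) (j - w + y) ↔ w ∈ crossed 0 y := by
        simp only [crossed, Finset.mem_Ioc]; omega
      simp only [Equiv.subLeft_apply, this]
    simp_rw [h3]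
    rw [tsum_eq_sum (s := crossed 0 y) (fun b hb => by simp [hb]), Finset.sum_ite_mem]
    simp [card_crossed]
  simp_rw [h1]
  rw [Summable.tsum_finsetSum fun _ _ => ENNReal.summable]
  simp [h2, card_crossed]

/-- By independence the integral over `W` can be done with `A` fixed, and there the law of `W` is at
most `ρ` times the counting measure. -/
theorem lintegral_indepFun_le {Ω α : Type*} [MeasurableSpace Ω] [MeasurableSpace α]
    {μ : Measure Ω} [IsProbabilityMeasure μ] {A : Ω → α} {W : Ω → ℤ} (hA : Measurable A)
    (hW : Measurable W) (hAW : IndepFun A W μ) {ρ : ENNReal} (hρ : ∀ w, μ {x | W x = w} ≤ ρ)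
    {G : α → ℤ → ENNReal} (hG : Measurable (Function.uncurry G)) :
    ∫⁻ x, G (A x) (W x) ∂μ ≤ ρ * ∫⁻ x, ∑' w, G (A x) w ∂μ := by
  have hprod := (indepFun_iff_map_prod_eq_prod_map_map hA.aemeasurable hW.aemeasurable).1 hAW
  have : IsProbabilityMeasure (μ.map W) := Measure.isProbabilityMeasure_map hW.aemeasurable
  have hGw : ∀ w, Measurable fun a => G a w := fun w => hG.comp measurable_prodMk_right
  calc ∫⁻ x, G (A x) (W x) ∂μ = ∫⁻ z, Function.uncurry G z ∂(μ.map fun x => (A x, W x)) := by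
        rw [lintegral_map hG (hA.prodMk hW)]; rfl
    _ = ∫⁻ x, ∫⁻ w, G (A x) w ∂(μ.map W) ∂μ := by
        rw [hprod, lintegral_prod _ hG.aemeasurable, lintegral_map hG.lintegral_prod_right' hA]
        rfl
    _ ≤ ∫⁻ x, ρ * ∑' w, G (A x) w ∂μ := by
        refine lintegral_mono fun x => ?_
        dsimp only
        rw [lintegral_countable', ← ENNReal.tsum_mul_left]
        refine ENNReal.tsum_le_tsum fun w => ?_
        rw [mul_comm, Measure.map_apply hW (MeasurableSet.singleton w)]
        exact mul_le_mul_left (hρ w) _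
    _ = _ := lintegral_const_mul _ (Measurable.tsum fun w => (hGw w).comp hA)

theorem lintegral_natAbs_jump {p : PMF ℤ}
    (hsummable : Summable fun k : ℤ => (k : ℝ) ^ 2 * (p k).toReal) (i : ℕ) :
    ∫⁻ ξ, ((ξ i).natAbs : ENNReal) ∂jumpLaw p = ENNReal.ofReal (meanAbsJump p) := by
  rw [← integral_abs_intCast hsummable, ← integral_comp_jump p (fun k => |(k : ℝ)|) i,
    ofReal_integral_eq_lintegral_ofReal
      ((memLp_two_jump hsummable i).integrable (by norm_num)).abs
      (ae_of_all _ fun _ => abs_nonneg _)]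
  refine lintegral_congr fun ξ => ?_
  rw [← Int.cast_abs, Int.abs_eq_natAbs, Int.cast_natCast, ENNReal.ofReal_natCast]

theorem lintegral_overlap_le {p : PMF ℤ}
    (hsummable : Summable fun k : ℤ => (k : ℝ) ^ 2 * (p k).toReal) {K : ℝ} (hK : 0 < K)
    (hconc : ∀ (s : Finset ℕ) (w : ℤ),
      jumpLaw p {ξ | ∑ l ∈ s, ξ l = w} ≤ ENNReal.ofReal (K / √(s.card + 1)))
    {i k : ℕ} (hik : i < k) :
    ∫⁻ ξ, (overlap ξ i k : ENNReal) ∂jumpLaw p ≤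
      ENNReal.ofReal (K * meanAbsJump p ^ 2 / √(k - i : ℕ)) := by
  have hm : 0 ≤ meanAbsJump p := tsum_nonneg fun k => by positivity
  have hA : Measurable fun ξ : ℕ → ℤ => (ξ i, ξ k) := by fun_prop
  have hW : Measurable fun ξ : ℕ → ℤ => ∑ l ∈ Finset.Ico (i + 1) k, ξ l := by fun_prop
  have hindep : IndepFun (fun ξ : ℕ → ℤ => (ξ i, ξ k))
      (fun ξ : ℕ → ℤ => ∑ l ∈ Finset.Ico (i + 1) k, ξ l) (jumpLaw p) := by
    have hd : Disjoint ({i, k} : Finset ℕ) (Finset.Ico (i + 1) k) := by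
      simp [Finset.disjoint_left]
    have h := (iIndepFun_jump p).indepFun_finset {i, k} (Finset.Ico (i + 1) k) hd
      fun l => measurable_pi_apply l
    have h' := h.comp (φ := fun x : ({i, k} : Finset ℕ) → ℤ =>
        (x ⟨i, by simp⟩, x ⟨k, by simp⟩))
      (ψ := fun x : Finset.Ico (i + 1) k → ℤ => ∑ l, x l) (by fun_prop) (by fun_prop)
    convert! h' using 1
    ext ξ
    exact (Finset.sum_coe_sort (Finset.Ico (i + 1) k) fun l => ξ l).symm
  -- There are `k - i - 1` intermediate jumps; the `+ 1` in the concentration bound restores `k -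
  -- i`.
  have hcard : (Finset.Ico (i + 1) k).card + 1 = k - i := by simp; omega
  have hcard' : ((Finset.Ico (i + 1) k).card : ℝ) + 1 = ((k - i : ℕ) : ℝ) := by
    rw [← hcard]; push_cast; ring
  have h := lintegral_indepFun_le hA hW hindep (hconc (Finset.Ico (i + 1) k))
    (G := fun a w => ((crossed (-a.1) 0 ∩ crossed w (w + a.2)).card : ENNReal))
    Measurable.of_discrete
  simp only [tsum_card_crossed_inter] at h
  have hmul : ∫⁻ ξ, ((ξ i).natAbs : ENNReal) * ((ξ k).natAbs : ENNReal) ∂jumpLaw p =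
      ENNReal.ofReal (meanAbsJump p) * ENNReal.ofReal (meanAbsJump p) := by
    have hind := ((iIndepFun_jump p).indepFun hik.ne).comp
      (φ := fun k : ℤ => (k.natAbs : ENNReal)) (ψ := fun k : ℤ => (k.natAbs : ENNReal))
      measurable_from_top measurable_from_top
    have hmeas : ∀ l : ℕ, Measurable fun ξ : ℕ → ℤ => ((ξ l).natAbs : ENNReal) := fun l =>
      (measurable_from_top (f := fun k : ℤ => (k.natAbs : ENNReal))).comp (measurable_pi_apply l)
    refine (lintegral_mul_eq_lintegral_mul_lintegral_of_indepFun (hmeas i) (hmeas k) hind).trans ?_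
    rw [lintegral_natAbs_jump hsummable, lintegral_natAbs_jump hsummable]
  rw [hmul, hcard', ← ENNReal.ofReal_mul hm, ← ENNReal.ofReal_mul (by positivity)] at h
  simp only [overlap_eq _ hik]
  refine h.trans (le_of_eq ?_)
  congr 1
  ring

theorem sum_inv_sqrt_le (n : ℕ) : ∑ d ∈ Finset.range n, 1 / √((d : ℝ) + 1) ≤ 2 * √n := by
  induction n with
  | zero => simp
  | succ n ih =>
    rw [Finset.sum_range_succ]
    push_cast
    have h1 : 0 < √((n : ℝ) + 1) := by positivity
    have h2 : √((n : ℝ) + 1) ^ 2 = n + 1 := Real.sq_sqrt (by positivity)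
    have h3 : √(n : ℝ) ^ 2 = n := Real.sq_sqrt (by positivity)
    have h4 : 1 / √((n : ℝ) + 1) ≤ 2 * √((n : ℝ) + 1) - 2 * √n := by
      rw [div_le_iff₀ h1]
      nlinarith [sq_nonneg (√((n : ℝ) + 1) - √n)]
    linarith

/-- With truncated subtraction the argument of `g` is `|k - i|`, and each distance occurs at most
twice. -/
theorem sum_dist_le (g : ℕ → ENNReal) {i n : ℕ} (hi : i < n) :
    ∑ k ∈ Finset.range n, g ((k - i) + (i - k)) ≤ 2 * ∑ d ∈ Finset.range n, g d := by
  obtain ⟨m, rfl⟩ := Nat.exists_eq_add_of_lt hi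
  rw [add_assoc, Finset.sum_range_add, two_mul]
  refine add_le_add ?_ ?_
  · have h1 : ∑ k ∈ Finset.range i, g (k - i + (i - k)) = ∑ d ∈ Finset.range i, g (d + 1) := by
      rw [← Finset.sum_range_reflect]
      refine Finset.sum_congr rfl fun k hk => ?_
      rw [Finset.mem_range] at hk
      congr 1
      omega
    rw [h1]
    have h2 : ∑ d ∈ Finset.range i, g (d + 1) ≤ ∑ d ∈ Finset.range (i + 1), g d := by
      rw [Finset.sum_range_succ']; exact le_self_add
    exact h2.trans (Finset.sum_le_sum_of_subset (Finset.range_mono (by omega)))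
  · have h1 : ∑ k ∈ Finset.range (m + 1), g (i + k - i + (i - (i + k))) =
        ∑ d ∈ Finset.range (m + 1), g d :=
      Finset.sum_congr rfl fun k _ => by congr 1; omega
    rw [h1]
    exact Finset.sum_le_sum_of_subset (Finset.range_mono (by omega))

/-- The expected overlap decays like the inverse square root of the time lag, so the double sum has
order `n ^ (3/2)`. Being `o(n ^ 2)`, it yields a law of large numbers by second moments. -/
theorem exists_lintegral_sum_overlap_le {p : PMF ℤ} (hsymm : ∀ k : ℤ, p (-k) = p k)
    (hsummable : Summable fun k : ℤ => (k : ℝ) ^ 2 * (p k).toReal) (h1 : 0 < (p 1).toReal) :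
    ∃ A : ℝ, 0 ≤ A ∧ ∀ n : ℕ, ∫⁻ ξ, (∑ i ∈ Finset.range n, ∑ k ∈ Finset.range n,
      (overlap ξ i k : ENNReal)) ∂jumpLaw p ≤ ENNReal.ofReal (A * (n * √n)) := by
  obtain ⟨K, hK, hconc⟩ := exists_measure_sum_jump_eq_le hsymm h1
  have hm : 0 ≤ meanAbsJump p := tsum_nonneg fun k => by positivity
  -- The first term covers the diagonal, where the overlap is `|ξ i|`; the `2` pays for replacing `1
  -- / √d` by `1 / √(d + 1)`.
  set B := meanAbsJump p + 2 * (K * meanAbsJump p ^ 2) with hB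
  have hB0 : 0 ≤ B := by positivity
  have hlt : ∀ i k : ℕ, i < k → ∫⁻ ξ, (overlap ξ i k : ENNReal) ∂jumpLaw p ≤
      ENNReal.ofReal (B / √(((k - i : ℕ) : ℝ) + 1)) := fun i k hik => by
    refine (lintegral_overlap_le hsummable hK hconc hik).trans (ENNReal.ofReal_le_ofReal ?_)
    have hd : (1 : ℝ) ≤ ((k - i : ℕ) : ℝ) := by exact_mod_cast (by omega : 1 ≤ k - i)
    have hsq : √(((k - i : ℕ) : ℝ) + 1) ≤ 2 * √((k - i : ℕ) : ℝ) := by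
      rw [Real.sqrt_le_left (by positivity), mul_pow, Real.sq_sqrt (by positivity)]
      linarith
    rw [div_le_div_iff₀ (by positivity) (by positivity)]
    have : 0 ≤ √((k - i : ℕ) : ℝ) := by positivity
    calc K * meanAbsJump p ^ 2 * √(((k - i : ℕ) : ℝ) + 1)
        ≤ K * meanAbsJump p ^ 2 * (2 * √((k - i : ℕ) : ℝ)) := by gcongr
      _ ≤ B * √((k - i : ℕ) : ℝ) := by rw [hB]; nlinarith
  have hall : ∀ i k : ℕ, ∫⁻ ξ, (overlap ξ i k : ENNReal) ∂jumpLaw p ≤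
      ENNReal.ofReal (B / √((((k - i) + (i - k) : ℕ) : ℝ) + 1)) := fun i k => by
    rcases lt_trichotomy i k with h | rfl | h
    · rw [show k - i + (i - k) = k - i by omega]; exact hlt i k h
    · simp only [overlap_self]
      rw [lintegral_natAbs_jump hsummable]
      refine ENNReal.ofReal_le_ofReal ?_
      simp only [le_refl, tsub_eq_zero_of_le, add_zero, Nat.cast_zero, zero_add, Real.sqrt_one,
        div_one, hB]
      have : 0 ≤ 2 * (K * meanAbsJump p ^ 2) := by positivity
      linarith
    · rw [show k - i + (i - k) = i - k by omega]
      simp only [overlap_comm _ i k]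
      exact hlt k i h
  have hw : ∀ i : ℕ, Measurable fun ξ : ℕ → ℤ => walk ξ i := measurable_walk
  have hmeas : ∀ i k : ℕ, Measurable fun ξ : ℕ → ℤ => (overlap ξ i k : ENNReal) := fun i k => by
    have h := (Measurable.of_discrete (f := fun z : (ℤ × ℤ) × (ℤ × ℤ) =>
      ((crossed z.1.1 z.1.2 ∩ crossed z.2.1 z.2.2).card : ENNReal))).comp
      (((hw i).prodMk (hw (i + 1))).prodMk ((hw k).prodMk (hw (k + 1))))
    simp only [Function.comp_def] at h
    simp only [overlap]
    exact h
  -- A factor `2` for the two signs of `k - i`, and a factor `2` from `sum_inv_sqrt_le`.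
  refine ⟨4 * B, by positivity, fun n => ?_⟩
  rw [lintegral_finsetSum _ fun i _ => Finset.measurable_sum _ fun k _ => hmeas i k]
  have hrow : ∀ i ∈ Finset.range n, ∫⁻ ξ, ∑ k ∈ Finset.range n, (overlap ξ i k : ENNReal)
      ∂jumpLaw p ≤ ENNReal.ofReal (4 * B * √n) := fun i hi => by
    rw [lintegral_finsetSum _ fun k _ => hmeas i k]
    refine (Finset.sum_le_sum fun k _ => hall i k).trans ?_
    refine (sum_dist_le (fun d => ENNReal.ofReal (B / √((d : ℝ) + 1)))
      (Finset.mem_range.1 hi)).trans ?_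
    rw [← ENNReal.ofReal_sum_of_nonneg fun d _ => by positivity, ← ENNReal.ofReal_ofNat,
      ← ENNReal.ofReal_mul (by norm_num)]
    refine ENNReal.ofReal_le_ofReal ?_
    have := sum_inv_sqrt_le n
    simp_rw [div_eq_mul_one_div B]
    rw [← Finset.mul_sum]
    nlinarith
  refine (Finset.sum_le_sum hrow).trans (le_of_eq ?_)
  rw [Finset.sum_const, Finset.card_range, nsmul_eq_mul, ← ENNReal.ofReal_natCast,
    ← ENNReal.ofReal_mul (by positivity)]
  congr 1
  ring

/-! ### Weighted lengths of the trajectory -/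

/-- The law of the i.i.d. gaps. -/
noncomputable abbrev gapLaw (F : Measure (Set.Ioi (0 : ℝ))) [IsProbabilityMeasure F] :
    Measure Gaps :=
  Measure.infinitePi fun _ : ℤ => F

/-- The length of the trajectory up to its `n`-th step, when a gap `x` is given the length
`h x`. -/
noncomputable def weightedLength (h : Set.Ioi (0 : ℝ) → ℝ) (ζ : Gaps) (ξ : ℕ → ℤ) (n : ℕ) : ℝ :=
  ∑ i ∈ Finset.range n, ∑ j ∈ crossed (walk ξ i) (walk ξ (i + 1)), h (ζ j)

theorem collisionTime_toEnvironment (ζ : Gaps) (ξ : ℕ → ℤ) (n : ℕ) :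
    collisionTime (toEnvironment ζ) ξ n = weightedLength (fun x => (x : ℝ)) ζ ξ n :=
  Finset.sum_congr rfl fun _ _ => abs_target_sub ζ _ _

theorem weightedLength_add (f g : Set.Ioi (0 : ℝ) → ℝ) (ζ : Gaps) (ξ : ℕ → ℤ) (n : ℕ) :
    weightedLength (fun x => f x + g x) ζ ξ n =
      weightedLength f ζ ξ n + weightedLength g ζ ξ n := by
  simp [weightedLength, Finset.sum_add_distrib]

theorem weightedLength_const (c : ℝ) (ζ : Gaps) (ξ : ℕ → ℤ) (n : ℕ) :
    weightedLength (fun _ => c) ζ ξ n = (∑ i ∈ Finset.range n, |(ξ i : ℝ)|) * c := by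
  simp only [weightedLength, Finset.sum_const, nsmul_eq_mul, ← Finset.sum_mul, card_crossed,
    walk_succ, add_sub_cancel_left, Nat.cast_natAbs, Int.cast_abs]

theorem weightedLength_nonneg {h : Set.Ioi (0 : ℝ) → ℝ} (hh : ∀ x, 0 ≤ h x) (ζ : Gaps)
    (ξ : ℕ → ℤ) (n : ℕ) : 0 ≤ weightedLength h ζ ξ n :=
  Finset.sum_nonneg fun _ _ => Finset.sum_nonneg fun _ _ => hh _

theorem monotone_weightedLength {h : Set.Ioi (0 : ℝ) → ℝ} (hh : ∀ x, 0 ≤ h x) (ζ : Gaps)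
    (ξ : ℕ → ℤ) : Monotone (weightedLength h ζ ξ) := by
  refine monotone_nat_of_le_succ fun n => ?_
  rw [weightedLength, weightedLength, Finset.sum_range_succ]
  exact le_add_of_nonneg_right (Finset.sum_nonneg fun j _ => hh _)

theorem measurable_sum_crossed {h : Set.Ioi (0 : ℝ) → ℝ} (hh : Measurable h) :
    Measurable fun z : (ℤ × ℤ) × Gaps => ∑ j ∈ crossed z.1.1 z.1.2, h (z.2 j) :=
  measurable_from_prod_countable_right fun x =>
    Finset.measurable_sum (crossed x.1 x.2) fun j _ => hh.comp (measurable_pi_apply j)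

theorem measurable_weightedLength {h : Set.Ioi (0 : ℝ) → ℝ} (hh : Measurable h) (n : ℕ) :
    Measurable fun z : (ℕ → ℤ) × Gaps => weightedLength h z.2 z.1 n := by
  unfold weightedLength
  refine Finset.measurable_sum _ fun i _ => ?_
  have h1 : Measurable fun z : (ℕ → ℤ) × Gaps => ((walk z.1 i, walk z.1 (i + 1)), z.2) :=
    (((measurable_walk i).comp measurable_fst).prodMk
      ((measurable_walk (i + 1)).comp measurable_fst)).prodMk measurable_snd
  exact (measurable_sum_crossed hh).comp h1

attribute [irreducible] weightedLength

/-! ### Second moments over the gaps and the law of large numbers for bounded weights. -/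

section GapLaw

variable {F : Measure (Set.Ioi (0 : ℝ))} [IsProbabilityMeasure F]

theorem measurePreserving_gap (j : ℤ) : MeasurePreserving (fun ζ : Gaps => ζ j) (gapLaw F) F :=
  measurePreserving_eval_infinitePi _ j

theorem integral_comp_gap (j : ℤ) {h : Set.Ioi (0 : ℝ) → ℝ} (hh : Measurable h) :
    ∫ ζ, h (ζ j) ∂gapLaw F = ∫ x, h x ∂F := by
  conv_rhs => rw [← (measurePreserving_gap (F := F) j).map_eq]
  rw [integral_map (measurable_pi_apply j).aemeasurable hh.aestronglyMeasurable]

theorem iIndepFun_comp_gap {h : Set.Ioi (0 : ℝ) → ℝ} (hh : Measurable h) :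
    iIndepFun (fun (j : ℤ) (ζ : Gaps) => h (ζ j)) (gapLaw F) :=
  iIndepFun_infinitePi (X := fun _ => h) fun _ => hh

/-- With the walk fixed, weights of distinct gaps are independent and centred; only pairs of
crossings of the same gap survive, and overlaps count them. -/
theorem integral_weightedLength_sq {h : Set.Ioi (0 : ℝ) → ℝ} (hh : Measurable h) {B : ℝ}
    (hB : ∀ x, |h x| ≤ B) (h0 : ∫ x, h x ∂F = 0) (ξ : ℕ → ℤ) (n : ℕ) :
    ∫ ζ, weightedLength h ζ ξ n ^ 2 ∂gapLaw F =
      (∫ x, h x ^ 2 ∂F) * ∑ i ∈ Finset.range n, ∑ k ∈ Finset.range n, (overlap ξ i k : ℝ) := by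
  have hcomp : ∀ j : ℤ, Measurable fun ζ : Gaps => h (ζ j) := fun j =>
    hh.comp (measurable_pi_apply j)
  have hint : ∀ j : ℤ, Integrable (fun ζ : Gaps => h (ζ j)) (gapLaw F) := fun j =>
    Integrable.of_bound (hcomp j).aestronglyMeasurable B (ae_of_all _ fun ζ => hB _)
  have hint2 : ∀ j l : ℤ, Integrable (fun ζ : Gaps => h (ζ j) * h (ζ l)) (gapLaw F) := fun j l =>
    Integrable.of_bound ((hcomp j).mul (hcomp l)).aestronglyMeasurable (B * B)
      (ae_of_all _ fun ζ => by
        rw [Real.norm_eq_abs, abs_mul]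
        exact mul_le_mul (hB _) (hB _) (abs_nonneg _) ((abs_nonneg _).trans (hB (ζ j))))
  have hprod : ∀ j l : ℤ, ∫ ζ, h (ζ j) * h (ζ l) ∂gapLaw F =
      if j = l then ∫ x, h x ^ 2 ∂F else 0 := fun j l => by
    split_ifs with hjl
    · subst hjl
      simp_rw [← sq]
      exact integral_comp_gap j (hh.pow_const 2)
    · rw [((iIndepFun_comp_gap (F := F) hh).indepFun hjl).integral_fun_mul_eq_mul_integral
        (hcomp j).aestronglyMeasurable (hcomp l).aestronglyMeasurable, integral_comp_gap j hh, h0,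
        zero_mul]
  have hexp : ∀ ζ : Gaps, weightedLength h ζ ξ n ^ 2 =
      ∑ i ∈ Finset.range n, ∑ k ∈ Finset.range n, ∑ j ∈ crossed (walk ξ i) (walk ξ (i + 1)),
        ∑ l ∈ crossed (walk ξ k) (walk ξ (k + 1)), h (ζ j) * h (ζ l) := fun ζ => by
    rw [sq, weightedLength, Finset.sum_mul_sum]
    exact Finset.sum_congr rfl fun i _ => Finset.sum_congr rfl fun k _ => Finset.sum_mul_sum _ _ _ _
  simp_rw [hexp]
  rw [integral_finsetSum _ fun i _ => integrable_finsetSum _ fun k _ =>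
    integrable_finsetSum _ fun j _ => integrable_finsetSum _ fun l _ => hint2 j l, Finset.mul_sum]
  refine Finset.sum_congr rfl fun i _ => ?_
  rw [integral_finsetSum _ fun k _ =>
    integrable_finsetSum _ fun j _ => integrable_finsetSum _ fun l _ => hint2 j l, Finset.mul_sum]
  refine Finset.sum_congr rfl fun k _ => ?_
  rw [integral_finsetSum _ fun j _ => integrable_finsetSum _ fun l _ => hint2 j l]
  have hj : ∀ j, ∫ ζ, ∑ l ∈ crossed (walk ξ k) (walk ξ (k + 1)), h (ζ j) * h (ζ l) ∂gapLaw F =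
      if j ∈ crossed (walk ξ k) (walk ξ (k + 1)) then ∫ x, h x ^ 2 ∂F else 0 := fun j => by
    rw [integral_finsetSum _ fun l _ => hint2 j l]
    simp_rw [hprod]
    rw [Finset.sum_ite_eq]
  simp_rw [hj]
  rw [Finset.sum_ite_mem, Finset.sum_const, nsmul_eq_mul, overlap, mul_comm]

/-- The second moment of the average at time `n` is `O(n ^ (-1/2))`, that is `O(k ^ (-2))` for `n =
k ^ 4`. The squares therefore have a sum of finite integral, so they are almost surely summable and
tend to `0`. -/
theorem ae_tendsto_weightedLength_pow_four {p : PMF ℤ} (hsymm : ∀ k : ℤ, p (-k) = p k)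
    (hsummable : Summable fun k : ℤ => (k : ℝ) ^ 2 * (p k).toReal) (h1 : 0 < (p 1).toReal)
    {h : Set.Ioi (0 : ℝ) → ℝ} (hh : Measurable h) {B : ℝ} (hB : ∀ x, |h x| ≤ B)
    (h0 : ∫ x, h x ∂F = 0) :
    ∀ᵐ z ∂(jumpLaw p).prod (gapLaw F),
      Tendsto (fun k : ℕ => weightedLength h z.2 z.1 (k ^ 4) / (k ^ 4 : ℕ)) atTop (𝓝 0) := by
  obtain ⟨A, hA, hov⟩ := exists_lintegral_sum_overlap_le hsymm hsummable h1
  have hv : 0 ≤ ∫ x, h x ^ 2 ∂F := integral_nonneg fun _ => sq_nonneg _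
  have hbound : ∀ n : ℕ, ∀ ξ : ℕ → ℤ, ∫⁻ ζ, ENNReal.ofReal (weightedLength h ζ ξ n ^ 2) ∂gapLaw F =
      ENNReal.ofReal (∫ x, h x ^ 2 ∂F) *
        ∑ i ∈ Finset.range n, ∑ k ∈ Finset.range n, (overlap ξ i k : ENNReal) := fun n ξ => by
    have hm : Measurable fun ζ : Gaps => weightedLength h ζ ξ n :=
      (measurable_weightedLength hh n).comp measurable_prodMk_left
    rw [← ofReal_integral_eq_lintegral_ofReal _ (ae_of_all _ fun _ => sq_nonneg _),
      integral_weightedLength_sq hh hB h0, ENNReal.ofReal_mul hv]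
    · congr 1
      rw [ENNReal.ofReal_sum_of_nonneg fun i _ => Finset.sum_nonneg fun k _ => Nat.cast_nonneg _]
      refine Finset.sum_congr rfl fun i _ => ?_
      rw [ENNReal.ofReal_sum_of_nonneg fun k _ => Nat.cast_nonneg _]
      simp
    · have hb : ∀ ζ, |weightedLength h ζ ξ n| ≤ weightedLength (fun _ => B) ζ ξ n := fun ζ => by
        simp only [weightedLength]
        refine (Finset.abs_sum_le_sum_abs _ _).trans (Finset.sum_le_sum fun i _ => ?_)
        exact (Finset.abs_sum_le_sum_abs _ _).trans (Finset.sum_le_sum fun j _ => hB _)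
      simp_rw [weightedLength_const] at hb
      refine Integrable.of_bound (hm.pow_const 2).aestronglyMeasurable
        (((∑ i ∈ Finset.range n, |(ξ i : ℝ)|) * B) ^ 2) (ae_of_all _ fun ζ => ?_)
      rw [norm_pow]
      exact pow_le_pow_left₀ (norm_nonneg _) (hb ζ) 2
  have hsum : ∀ k : ℕ, ∫⁻ z, ENNReal.ofReal ((weightedLength h z.2 z.1 (k ^ 4) / (k ^ 4 : ℕ)) ^ 2)
      ∂(jumpLaw p).prod (gapLaw F) ≤
      ENNReal.ofReal ((∫ x, h x ^ 2 ∂F) * A * (1 / (k : ℝ) ^ 2)) := fun k => by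
    -- At `k = 0` both sides are `0`, by the convention for division by zero.
    rcases Nat.eq_zero_or_pos k with rfl | hk
    · simp
    have hk' : (0 : ℝ) < k := by exact_mod_cast hk
    have hdiv : ∀ z : (ℕ → ℤ) × Gaps,
        ENNReal.ofReal ((weightedLength h z.2 z.1 (k ^ 4) / (k ^ 4 : ℕ)) ^ 2) =
        ENNReal.ofReal (1 / (k : ℝ) ^ 8) *
          ENNReal.ofReal (weightedLength h z.2 z.1 (k ^ 4) ^ 2) := fun z => by
      rw [← ENNReal.ofReal_mul (by positivity)]
      congr 1
      push_cast
      field_simp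
    simp_rw [hdiv]
    have hm := ((measurable_weightedLength hh (k ^ 4)).pow_const 2).ennreal_ofReal
    rw [lintegral_const_mul _ hm, lintegral_prod _ hm.aemeasurable]
    simp_rw [hbound]
    rw [lintegral_const_mul' _ _ ENNReal.ofReal_ne_top]
    calc ENNReal.ofReal (1 / (k : ℝ) ^ 8) * (ENNReal.ofReal (∫ x, h x ^ 2 ∂F) * _)
        ≤ ENNReal.ofReal (1 / (k : ℝ) ^ 8) * (ENNReal.ofReal (∫ x, h x ^ 2 ∂F) *
          ENNReal.ofReal (A * ((k ^ 4 : ℕ) * √(k ^ 4 : ℕ)))) := by gcongr; exact hov (k ^ 4)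
      _ = _ := by
        rw [← ENNReal.ofReal_mul hv, ← ENNReal.ofReal_mul (by positivity)]
        congr 1
        have : √((k ^ 4 : ℕ) : ℝ) = (k : ℝ) ^ 2 := by
          rw [Real.sqrt_eq_iff_mul_self_eq_of_pos (by positivity)]
          push_cast
          ring
        rw [this]
        push_cast
        field_simp
  have hfin : ∫⁻ z, ∑' k : ℕ, ENNReal.ofReal
      ((weightedLength h z.2 z.1 (k ^ 4) / (k ^ 4 : ℕ)) ^ 2) ∂(jumpLaw p).prod (gapLaw F) ≠ ⊤ := by
    rw [lintegral_tsum fun k => (((measurable_weightedLength hh (k ^ 4)).div_const _).pow_const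
      2).ennreal_ofReal.aemeasurable]
    refine ne_top_of_le_ne_top ?_ (ENNReal.tsum_le_tsum hsum)
    rw [← ENNReal.ofReal_tsum_of_nonneg (fun k => by positivity)
      ((Real.summable_one_div_nat_pow.2 (by norm_num)).mul_left _)]
    exact ENNReal.ofReal_ne_top
  have hae := ae_lt_top' (AEMeasurable.tsum fun k =>
    (((measurable_weightedLength hh (k ^ 4)).div_const ((k ^ 4 : ℕ) : ℝ)).pow_const
      2).ennreal_ofReal.aemeasurable) hfin
  filter_upwards [hae] with z hz
  have h2 := ENNReal.tendsto_atTop_zero_of_tsum_ne_top hz.ne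
  have h3 := (ENNReal.tendsto_toReal ENNReal.zero_ne_top).comp h2
  have h4 : Tendsto (fun k : ℕ => (weightedLength h z.2 z.1 (k ^ 4) / (k ^ 4 : ℕ)) ^ 2) atTop
      (𝓝 0) := by
    convert! h3 using 2 with k
    simp only [Function.comp_apply]
    rw [ENNReal.toReal_ofReal (sq_nonneg _)]
  rw [tendsto_zero_iff_abs_tendsto_zero]
  have h5 := (Real.continuous_sqrt.tendsto 0).comp h4
  simpa [Function.comp_def, Real.sqrt_sq_eq_abs] using h5

theorem ae_tendsto_sum_abs_jump_div {p : PMF ℤ}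
    (hsummable : Summable fun k : ℤ => (k : ℝ) ^ 2 * (p k).toReal) :
    ∀ᵐ ξ ∂jumpLaw p, Tendsto (fun n : ℕ => (∑ i ∈ Finset.range n, |(ξ i : ℝ)|) / n) atTop
      (𝓝 (meanAbsJump p)) := by
  have h := strong_law_ae_real (μ := jumpLaw p) (fun i (ξ : ℕ → ℤ) => |(ξ i : ℝ)|)
    ((memLp_two_jump hsummable 0).integrable (by norm_num)).abs
    (fun i j hij => (iIndepFun_comp_jump p fun k => |(k : ℝ)|).indepFun hij)
    (fun i => identDistrib_comp_jump p (fun k => |(k : ℝ)|) i 0)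
  rwa [integral_comp_jump p (fun k => |(k : ℝ)|) 0, integral_abs_intCast hsummable] at h

theorem tendsto_natCast_pow_four_atTop : Tendsto (fun k : ℕ => k ^ 4) atTop atTop :=
  tendsto_pow_atTop (by norm_num)

/-- The law of large numbers for weighted lengths, for bounded weights. -/
theorem ae_tendsto_weightedLength_div_of_bounded {p : PMF ℤ} (hsymm : ∀ k : ℤ, p (-k) = p k)
    (hsummable : Summable fun k : ℤ => (k : ℝ) ^ 2 * (p k).toReal) (h1 : 0 < (p 1).toReal)
    {h : Set.Ioi (0 : ℝ) → ℝ} (hh : Measurable h) (h0 : ∀ x, 0 ≤ h x) {B : ℝ}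
    (hB : ∀ x, h x ≤ B) :
    ∀ᵐ z ∂(jumpLaw p).prod (gapLaw F),
      Tendsto (fun n : ℕ => weightedLength h z.2 z.1 n / n) atTop
        (𝓝 (meanAbsJump p * ∫ x, h x ∂F)) := by
  set m := ∫ x, h x ∂F with hm
  have hint : Integrable h F := Integrable.of_bound hh.aestronglyMeasurable B
    (ae_of_all _ fun x => by rw [Real.norm_eq_abs, abs_of_nonneg (h0 x)]; exact hB x)
  have hc := ae_tendsto_weightedLength_pow_four (F := F) hsymm hsummable h1
    (h := fun x => h x - m) (hh.sub_const m) (B := B + |m|)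
    (fun x => (abs_sub _ _).trans (add_le_add (by rw [abs_of_nonneg (h0 x)]; exact hB x) le_rfl))
    (by rw [integral_sub hint (integrable_const _)]; simp [hm])
  have hlln : ∀ᵐ z ∂(jumpLaw p).prod (gapLaw F), Tendsto
      (fun n : ℕ => (∑ i ∈ Finset.range n, |(z.1 i : ℝ)|) / n) atTop (𝓝 (meanAbsJump p)) :=
    Measure.quasiMeasurePreserving_fst.ae (ae_tendsto_sum_abs_jump_div hsummable)
  filter_upwards [hc, hlln] with z hz1 hz2
  -- Lengths with nonnegative weights increase with `n`, and `(k + 1) ^ 4 / k ^ 4 → 1`, so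
  -- convergence along fourth powers suffices.
  refine tendsto_div_of_monotone_of_exists_subseq_tendsto_div _ _
    (monotone_weightedLength h0 z.2 z.1) fun a ha => ⟨fun k => k ^ 4, ?_,
      tendsto_natCast_pow_four_atTop, ?_⟩
  · have hlim : Tendsto (fun k : ℕ => (1 + 1 / (k : ℝ)) ^ 4) atTop (𝓝 1) := by
      have := ((tendsto_one_div_atTop_nhds_zero_nat (𝕜 := ℝ)).const_add 1).pow 4
      simpa using this
    filter_upwards [hlim.eventually_lt_const ha, eventually_gt_atTop 0] with k hk hk0
    have hk' : (0 : ℝ) < k := by exact_mod_cast hk0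
    have e : (((k + 1) ^ 4 : ℕ) : ℝ) = (1 + 1 / (k : ℝ)) ^ 4 * ((k ^ 4 : ℕ) : ℝ) := by
      push_cast
      rw [← mul_pow]
      congr 1
      field_simp
    rw [e]
    gcongr
  -- The constant part `m` of the weight contributes `m` times the sum of the `|ξ i|`, handled by
  -- the strong law for the jumps.
  · have h3 := hz1.add ((hz2.comp tendsto_natCast_pow_four_atTop).mul_const m)
    rw [zero_add] at h3
    refine h3.congr fun k => ?_
    have e := weightedLength_add (fun x => h x - m) (fun _ => m) z.2 z.1 (k ^ 4)
    simp only [sub_add_cancel] at e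
    rw [e, weightedLength_const, add_div, Function.comp_apply]
    ring

end GapLaw

/-! ### The maximal ergodic inequality -/

section Maximal

variable {α : Type*} {T : α → α} {f : α → ℝ}

/-- The maximum of the Birkhoff sums of length at most `N`. -/
def birkhoffMax (T : α → α) (f : α → ℝ) : ℕ → α → ℝ
  | 0, _ => 0
  | N + 1, x => max (f x + birkhoffMax T f N (T x)) 0

theorem birkhoffMax_nonneg (N : ℕ) (x : α) : 0 ≤ birkhoffMax T f N x := by
  cases N with
  | zero => exact le_rfl
  | succ N => exact le_max_right _ _

theorem birkhoffMax_le_succ (N : ℕ) (x : α) :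
    birkhoffMax T f N x ≤ birkhoffMax T f (N + 1) x := by
  induction N generalizing x with
  | zero => exact birkhoffMax_nonneg 1 x
  | succ N ih => exact max_le_max (add_le_add le_rfl (ih (T x))) le_rfl

theorem birkhoffSum_le_birkhoffMax {n N : ℕ} (hn : n ≤ N) (x : α) :
    birkhoffSum T f n x ≤ birkhoffMax T f N x := by
  induction N generalizing n x with
  | zero => obtain rfl : n = 0 := by omega
            simp [birkhoffMax]
  | succ N ih =>
    rcases n with _ | n
    · simpa using birkhoffMax_nonneg (N + 1) x
    · rw [birkhoffSum_succ']
      exact (add_le_add le_rfl (ih (by omega) (T x))).trans (le_max_left _ _)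

/-- Garsia's inequality: where the maximum is positive it equals `f` plus the shorter maximum at `T
x`, which is at most the full maximum there; elsewhere it is `0`, while the maximum at `T x` is
nonnegative. -/
theorem birkhoffMax_sub_le (N : ℕ) (x : α) :
    birkhoffMax T f N x - birkhoffMax T f N (T x) ≤
      {x | 0 < birkhoffMax T f N x}.indicator f x := by
  by_cases hx : 0 < birkhoffMax T f N x
  · rw [Set.indicator_of_mem (by exact hx)]
    rcases N with _ | N
    · exact absurd hx (lt_irrefl _)
    · have h1 : birkhoffMax T f (N + 1) x = f x + birkhoffMax T f N (T x) := by
        refine max_eq_left ?_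
        by_contra hcon
        exact absurd hx (by rw [birkhoffMax, max_eq_right (not_le.1 hcon).le]; simp)
      linarith [birkhoffMax_le_succ (T := T) (f := f) N (T x)]
  · rw [Set.indicator_of_notMem (by exact hx)]
    linarith [birkhoffMax_nonneg (T := T) (f := f) N (T x), not_lt.1 hx]

variable [MeasurableSpace α] {μ : Measure α} (hT : MeasurePreserving T μ μ) (hf : Measurable f) (hfi : Integrable f μ)

include hT hf in
theorem measurable_birkhoffMax (N : ℕ) : Measurable (birkhoffMax T f N) := by
  induction N with
  | zero => exact measurable_const
  | succ N ih => exact (hf.add (ih.comp hT.measurable)).max measurable_const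

include hT hfi in
theorem integrable_birkhoffMax (N : ℕ) : Integrable (birkhoffMax T f N) μ := by
  induction N with
  | zero => exact integrable_zero _ _ _
  | succ N ih => exact (hfi.add (hT.integrable_comp_of_integrable ih)).pos_part

include hT hf hfi in
-- Integrate `birkhoffMax_sub_le`: by invariance of the measure its left side has integral zero.
theorem setIntegral_birkhoffMax_pos_nonneg (N : ℕ) :
    0 ≤ ∫ x in {x | 0 < birkhoffMax T f N x}, f x ∂μ := by
  have hmeas : MeasurableSet {x | 0 < birkhoffMax T f N x} :=
    measurableSet_lt measurable_const (measurable_birkhoffMax hT hf N)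
  have hi := integrable_birkhoffMax hT hfi N
  have hiT : Integrable (fun x => birkhoffMax T f N (T x)) μ := hT.integrable_comp_of_integrable hi
  have h0 : ∫ x, (birkhoffMax T f N x - birkhoffMax T f N (T x)) ∂μ = 0 := by
    rw [integral_sub hi hiT, sub_eq_zero]
    conv_lhs => rw [← hT.map_eq]
    rw [integral_map hT.measurable.aemeasurable
      (measurable_birkhoffMax hT hf N).aestronglyMeasurable]
  rw [← integral_indicator hmeas]
  exact h0.symm.le.trans
    (integral_mono (hi.sub hiT) (hfi.indicator hmeas) fun x => birkhoffMax_sub_le N x)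

include hT hf hfi in
/-- The weak type maximal inequality for the averages of a nonnegative function. -/
theorem measure_exists_lt_birkhoffSum_le [IsFiniteMeasure μ] (h0 : ∀ x, 0 ≤ f x) {c : ℝ}
    (hc : 0 < c) :
    μ {x | ∃ n : ℕ, n * c < birkhoffSum T f n x} ≤ ENNReal.ofReal ((∫ x, f x ∂μ) / c) := by
  have hg : Measurable fun x => f x - c := hf.sub_const c
  have hgi : Integrable (fun x => f x - c) μ := hfi.sub (integrable_const c)
  set E : ℕ → Set α := fun N => {x | 0 < birkhoffMax T (fun x => f x - c) N x} with hE
  have hEmeas : ∀ N, MeasurableSet (E N) := fun N =>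
    measurableSet_lt measurable_const (measurable_birkhoffMax hT hg N)
  have hmono : Monotone E := monotone_nat_of_le_succ fun N x hx =>
    lt_of_lt_of_le (show 0 < birkhoffMax T (fun x => f x - c) N x from hx) (birkhoffMax_le_succ N x)
  have hsub : {x | ∃ n : ℕ, n * c < birkhoffSum T f n x} ⊆ ⋃ N, E N := by
    rintro x ⟨n, hn⟩
    refine Set.mem_iUnion.2 ⟨n, ?_⟩
    refine lt_of_lt_of_le ?_ (birkhoffSum_le_birkhoffMax (le_refl n) x)
    have : birkhoffSum T (fun x => f x - c) n x = birkhoffSum T f n x - n * c := by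
      simp [birkhoffSum, Finset.sum_sub_distrib]
    linarith
  refine (measure_mono hsub).trans ?_
  rw [hmono.measure_iUnion]
  refine iSup_le fun N => ?_
  -- For `f - c` this reads `c μ(E N) ≤ ∫ f` over `E N`.
  have h1 := setIntegral_birkhoffMax_pos_nonneg hT hg hgi N
  rw [integral_sub hfi.integrableOn (integrable_const c).integrableOn, setIntegral_const,
    smul_eq_mul] at h1
  have h2 : ∫ x in E N, f x ∂μ ≤ ∫ x, f x ∂μ := setIntegral_le_integral hfi (ae_of_all _ h0)
  rw [← ENNReal.ofReal_toReal (measure_ne_top μ (E N))]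
  refine ENNReal.ofReal_le_ofReal ?_
  rw [le_div_iff₀ hc]
  exact (sub_nonneg.1 h1).trans h2

end Maximal

/-! ### The environment seen from the particle -/

/-- One step of the environment seen from the particle. -/
def environmentStep (z : (ℕ → ℤ) × Gaps) : (ℕ → ℤ) × Gaps :=
  (fun i => z.1 (i + 1), fun j => z.2 (j + z.1 0))

theorem environmentStep_iterate (n : ℕ) (z : (ℕ → ℤ) × Gaps) :
    environmentStep^[n] z = (fun i => z.1 (i + n), fun j => z.2 (j + walk z.1 n)) := by
  induction n with
  | zero => simp [walk]
  | succ n ih =>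
    rw [Function.iterate_succ_apply', ih, environmentStep]
    refine Prod.ext (funext fun i => ?_) (funext fun j => ?_)
    · exact congrArg z.1 (by ring)
    · refine congrArg z.2 ?_
      simp only [walk_succ, zero_add]
      ring

/-- Seen from the particle, every step is a first step from the origin. Lengths thus become Birkhoff
sums, to which the maximal inequality applies. -/
theorem weightedLength_eq_birkhoffSum (h : Set.Ioi (0 : ℝ) → ℝ) (z : (ℕ → ℤ) × Gaps) (n : ℕ) :
    weightedLength h z.2 z.1 n =
      birkhoffSum environmentStep (fun z => weightedLength h z.2 z.1 1) n z := by
  rw [birkhoffSum, weightedLength]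
  refine Finset.sum_congr rfl fun i _ => ?_
  rw [environmentStep_iterate]
  simp only [weightedLength, Finset.sum_range_one]
  have e0 : walk (fun l => z.1 (l + i)) 0 = 0 := by simp [walk]
  have e1 : walk (fun l => z.1 (l + i)) (0 + 1) = z.1 i := by simp [walk]
  rw [e0, e1]
  refine (Finset.sum_bij (fun j _ => j + walk z.1 i) (fun j hj => ?_) (fun j _ l _ hjl => ?_)
    (fun j hj => ⟨j - walk z.1 i, ?_, by ring⟩) fun j _ => rfl).symm
  · rw [← add_mem_crossed _ _ (walk z.1 i)] at hj
    rwa [zero_add, add_comm (z.1 i), ← walk_succ] at hj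
  · simpa using hjl
  · rw [← add_mem_crossed _ _ (walk z.1 i), zero_add, add_comm (z.1 i), ← walk_succ]
    rwa [sub_add_cancel]

theorem tendsto_integral_sub_min {F : Measure (Set.Ioi (0 : ℝ))} {h : Set.Ioi (0 : ℝ) → ℝ}
    (h0 : ∀ x, 0 ≤ h x) (hi : Integrable h F) :
    Tendsto (fun M : ℕ => ∫ x, (h x - min (h x) M) ∂F) atTop (𝓝 0) := by
  have h1 : Tendsto (fun M : ℕ => ∫ x, (h x - min (h x) M) ∂F) atTop (𝓝 (∫ _x, (0 : ℝ) ∂F)) := by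
    refine tendsto_integral_of_dominated_convergence h (fun M => ?_) hi (fun M => ?_) ?_
    · exact hi.aestronglyMeasurable.sub (hi.aestronglyMeasurable.inf aestronglyMeasurable_const)
    · refine ae_of_all _ fun x => ?_
      have : 0 ≤ min (h x) M := le_min (h0 x) (Nat.cast_nonneg M)
      rw [Real.norm_eq_abs, abs_of_nonneg (sub_nonneg.2 (min_le_left _ _))]
      linarith
    · refine ae_of_all _ fun x => tendsto_const_nhds.congr' ?_
      filter_upwards [eventually_ge_atTop ⌈h x⌉₊] with M hM
      rw [min_eq_left (Nat.ceil_le.1 hM), sub_self]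
  simpa using h1

/-! ### Invariance of the environment seen from the particle, and integrable weights. -/

section Annealed

variable {F : Measure (Set.Ioi (0 : ℝ))} [IsProbabilityMeasure F] {p : PMF ℤ}

/-- A skew product: dropping a jump preserves the i.i.d. jumps and, for each fixed walk, translation
by `ξ 0` preserves the i.i.d. gaps. -/
theorem measurePreserving_environmentStep :
    MeasurePreserving environmentStep ((jumpLaw p).prod (gapLaw F))
      ((jumpLaw p).prod (gapLaw F)) := by
  refine (measurePreserving_shift p 1).skew_product
    (g := fun (ξ : ℕ → ℤ) (ζ : Gaps) (j : ℤ) => ζ (j + ξ 0)) ?_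
    (ae_of_all _ fun ξ => Measure.map_infinitePi_infinitePi_of_inj (P := fun _ : ℤ => F)
      (add_left_injective (ξ 0)))
  refine measurable_pi_lambda _ fun j => ?_
  have h1 : Measurable fun z : ℤ × Gaps => z.2 (j + z.1) :=
    measurable_from_prod_countable_right fun x => measurable_pi_apply (j + x)
  have h2 : Measurable fun z : (ℕ → ℤ) × Gaps => (z.1 0, z.2) :=
    ((measurable_pi_apply 0).comp measurable_fst).prodMk measurable_snd
  exact h1.comp h2

variable (hsummable : Summable fun k : ℤ => (k : ℝ) ^ 2 * (p k).toReal)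
  {h : Set.Ioi (0 : ℝ) → ℝ} (hh : Measurable h) (h0 : ∀ x, 0 ≤ h x) (hi : Integrable h F)

include hsummable hh h0 hi

theorem lintegral_weightedLength_one :
    ∫⁻ z, ENNReal.ofReal (weightedLength h z.2 z.1 1) ∂(jumpLaw p).prod (gapLaw F) =
      ENNReal.ofReal (meanAbsJump p * ∫ x, h x ∂F) := by
  have hm := (measurable_weightedLength hh 1).ennreal_ofReal
  have hm0 : 0 ≤ meanAbsJump p := tsum_nonneg fun k => by positivity
  have hgap : ∀ j : ℤ, ∫⁻ ζ, ENNReal.ofReal (h (ζ j)) ∂gapLaw F =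
      ENNReal.ofReal (∫ x, h x ∂F) := fun j => by
    rw [ofReal_integral_eq_lintegral_ofReal hi (ae_of_all _ h0)]
    exact (measurePreserving_gap j).lintegral_comp hh.ennreal_ofReal
  rw [lintegral_prod _ hm.aemeasurable]
  have hin : ∀ ξ : ℕ → ℤ, ∫⁻ ζ, ENNReal.ofReal (weightedLength h ζ ξ 1) ∂gapLaw F =
      ((ξ 0).natAbs : ENNReal) * ENNReal.ofReal (∫ x, h x ∂F) := fun ξ => by
    simp only [weightedLength, Finset.sum_range_one]
    simp_rw [ENNReal.ofReal_sum_of_nonneg fun j _ => h0 _]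
    rw [lintegral_finsetSum (crossed (walk ξ 0) (walk ξ (0 + 1)))
      (f := fun j (ζ : Gaps) => ENNReal.ofReal (h (ζ j)))
      fun j _ => (hh.comp (measurable_pi_apply j)).ennreal_ofReal]
    simp_rw [hgap]
    rw [Finset.sum_const, nsmul_eq_mul, card_crossed, walk_succ, add_sub_cancel_left]
  simp only [hin]
  rw [lintegral_mul_const' _ _ ENNReal.ofReal_ne_top, lintegral_natAbs_jump hsummable,
    ← ENNReal.ofReal_mul hm0]

theorem integrable_weightedLength_one :
    Integrable (fun z => weightedLength h z.2 z.1 1) ((jumpLaw p).prod (gapLaw F)) := by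
  refine ⟨(measurable_weightedLength hh 1).aestronglyMeasurable, ?_⟩
  rw [hasFiniteIntegral_iff_ofReal (ae_of_all _ fun z => ?_),
    lintegral_weightedLength_one hsummable hh h0 hi]
  · exact ENNReal.ofReal_lt_top
  · exact weightedLength_nonneg h0 z.2 z.1 1

theorem integral_weightedLength_one :
    ∫ z, weightedLength h z.2 z.1 1 ∂(jumpLaw p).prod (gapLaw F) =
      meanAbsJump p * ∫ x, h x ∂F := by
  have hm0 : 0 ≤ meanAbsJump p := tsum_nonneg fun k => by positivity
  rw [integral_eq_lintegral_of_nonneg_ae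
    (f := fun z : (ℕ → ℤ) × Gaps => weightedLength h z.2 z.1 1)
    (ae_of_all _ fun z => weightedLength_nonneg h0 z.2 z.1 1)
    (measurable_weightedLength hh 1).aestronglyMeasurable,
    lintegral_weightedLength_one hsummable hh h0 hi,
    ENNReal.toReal_ofReal (mul_nonneg hm0 (integral_nonneg h0))]

/-- Controls all averages at once through the mean of the weight alone, hence applies to truncation
remainders without a second moment. -/
theorem measure_exists_lt_weightedLength_le {c : ℝ} (hc : 0 < c) :
    (jumpLaw p).prod (gapLaw F) {z | ∃ n : ℕ, n * c < weightedLength h z.2 z.1 n} ≤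
      ENNReal.ofReal (meanAbsJump p * (∫ x, h x ∂F) / c) := by
  have hset : {z : (ℕ → ℤ) × Gaps | ∃ n : ℕ, n * c < weightedLength h z.2 z.1 n} =
      {z | ∃ n : ℕ, n * c <
        birkhoffSum environmentStep (fun z => weightedLength h z.2 z.1 1) n z} := by
    ext z
    exact exists_congr fun n => by rw [weightedLength_eq_birkhoffSum h z n]
  rw [hset]
  rw [← integral_weightedLength_one hsummable hh h0 hi]
  exact measure_exists_lt_birkhoffSum_le measurePreserving_environmentStep
    (measurable_weightedLength hh 1) (integrable_weightedLength_one hsummable hh h0 hi)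
    (fun z => weightedLength_nonneg h0 z.2 z.1 1) hc

/-- The law of large numbers for weighted lengths. -/
theorem ae_tendsto_weightedLength_div (hsymm : ∀ k : ℤ, p (-k) = p k) (h1 : 0 < (p 1).toReal) :
    ∀ᵐ z ∂(jumpLaw p).prod (gapLaw F),
      Tendsto (fun n : ℕ => weightedLength h z.2 z.1 n / n) atTop
        (𝓝 (meanAbsJump p * ∫ x, h x ∂F)) := by
  have hm0 : 0 ≤ meanAbsJump p := tsum_nonneg fun k => by positivity
  have hmin : ∀ M : ℕ, Measurable fun x => min (h x) (M : ℝ) := fun M => hh.min measurable_const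
  have hmin0 : ∀ (M : ℕ) x, 0 ≤ min (h x) (M : ℝ) := fun M x =>
    le_min (h0 x) (Nat.cast_nonneg M)
  have hsub0 : ∀ (M : ℕ) x, 0 ≤ h x - min (h x) (M : ℝ) := fun M x =>
    sub_nonneg.2 (min_le_left _ _)
  have himin : ∀ M : ℕ, Integrable (fun x => min (h x) (M : ℝ)) F := fun M =>
    hi.mono' (hmin M).aestronglyMeasurable (ae_of_all _ fun x => by
      rw [Real.norm_eq_abs, abs_of_nonneg (hmin0 M x)]; exact min_le_left _ _)
  have hisub : ∀ M : ℕ, Integrable (fun x => h x - min (h x) (M : ℝ)) F := fun M =>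
    hi.sub (himin M)
  have hbdd : ∀ᵐ z ∂(jumpLaw p).prod (gapLaw F), ∀ M : ℕ,
      Tendsto (fun n : ℕ => weightedLength (fun x => min (h x) (M : ℝ)) z.2 z.1 n / n) atTop
        (𝓝 (meanAbsJump p * ∫ x, min (h x) (M : ℝ) ∂F)) :=
    ae_all_iff.2 fun M => ae_tendsto_weightedLength_div_of_bounded hsymm hsummable h1 (hmin M)
      (hmin0 M) (fun x => min_le_right _ _)
  have hlim : Tendsto (fun M : ℕ => meanAbsJump p * ∫ x, (h x - min (h x) M) ∂F) atTop (𝓝 0) := by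
    simpa using (tendsto_integral_sub_min h0 hi).const_mul (meanAbsJump p)
  -- The event that every `M ≥ M₀` fails is contained in the failure event of each such `M`, whose
  -- probability tends to `0` by the maximal inequality. One good `M` is enough, so no summability
  -- in `M` is needed.
  have htail : ∀ᵐ z ∂(jumpLaw p).prod (gapLaw F), ∀ q M₀ : ℕ, ∃ M ≥ M₀, ∀ n : ℕ,
      weightedLength (fun x => h x - min (h x) (M : ℝ)) z.2 z.1 n ≤ n * (1 / ((q : ℝ) + 1)) := by
    refine ae_all_iff.2 fun q => ae_all_iff.2 fun M₀ => ?_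
    rw [ae_iff, ← nonpos_iff_eq_zero]
    have hq : (0 : ℝ) < 1 / ((q : ℝ) + 1) := by positivity
    have hlim2 : Tendsto (fun M : ℕ => ENNReal.ofReal
        (meanAbsJump p * (∫ x, (h x - min (h x) M) ∂F) / (1 / ((q : ℝ) + 1)))) atTop (𝓝 0) := by
      have := ENNReal.tendsto_ofReal (hlim.div_const (1 / ((q : ℝ) + 1)))
      simpa only [zero_div, ENNReal.ofReal_zero] using this
    refine ge_of_tendsto hlim2 ?_
    filter_upwards [eventually_ge_atTop M₀] with M hM
    refine (measure_mono fun z hz => ?_).trans (measure_exists_lt_weightedLength_le hsummable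
      (hh.sub (hmin M)) (hsub0 M) (hisub M) hq)
    simp only [Set.mem_ofPred_eq] at hz ⊢
    push Not at hz
    exact hz M hM
  filter_upwards [hbdd, htail] with z hz1 hz2
  rw [Metric.tendsto_atTop]
  intro ε hε
  obtain ⟨q, hq⟩ := exists_nat_one_div_lt (show 0 < ε / 3 by positivity)
  obtain ⟨M₀, hM₀⟩ := eventually_atTop.1 (hlim.eventually_lt_const (show 0 < ε / 3 by positivity))
  obtain ⟨M, hM, htl⟩ := hz2 q M₀
  obtain ⟨N, hN⟩ := Metric.tendsto_atTop.1 (hz1 M) (ε / 3) (by positivity)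
  refine ⟨max N 1, fun n hn => ?_⟩
  have hn0 : (0 : ℝ) < n := by exact_mod_cast (le_of_max_le_right hn)
  have e1 := hN n (le_of_max_le_left hn)
  have e2 := htl n
  have e3 := hM₀ M hM
  have e4 : weightedLength h z.2 z.1 n = weightedLength (fun x => min (h x) (M : ℝ)) z.2 z.1 n +
      weightedLength (fun x => h x - min (h x) (M : ℝ)) z.2 z.1 n := by
    rw [← weightedLength_add]; simp
  have e5 : 0 ≤ weightedLength (fun x => h x - min (h x) (M : ℝ)) z.2 z.1 n / n :=
    div_nonneg (weightedLength_nonneg (hsub0 M) z.2 z.1 n) hn0.le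
  have e6 : weightedLength (fun x => h x - min (h x) (M : ℝ)) z.2 z.1 n / n < ε / 3 := by
    rw [div_lt_iff₀ hn0]
    nlinarith
  have e7 : 0 ≤ meanAbsJump p * ∫ x, (h x - min (h x) M) ∂F :=
    mul_nonneg hm0 (integral_nonneg (hsub0 M))
  rw [integral_sub hi (himin M), mul_sub] at e3 e7
  rw [Real.dist_eq, abs_lt] at e1 ⊢
  rw [e4, add_div]
  constructor <;> linarith

end Annealed

/-! ### Almost every environment -/

/-- The gaps of an environment. -/
def gapsOf (ω : Environment) : Gaps := fun k =>
  ⟨ω.1 k - ω.1 (k - 1), sub_pos.2 (ω.2.2 (by omega))⟩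

theorem measurable_gapsOf : Measurable gapsOf := by
  refine measurable_pi_lambda _ fun k => Measurable.subtype_mk ?_
  exact ((measurable_pi_apply k).comp measurable_subtype_coe).sub
    ((measurable_pi_apply (k - 1)).comp measurable_subtype_coe)

theorem gapsOf_toEnvironment (ζ : Gaps) : gapsOf (toEnvironment ζ) = ζ := by
  funext k
  refine Subtype.ext ?_
  change target ζ k - target ζ (k - 1) = ζ k
  rw [target_eq ζ k]
  ring

theorem toEnvironment_gapsOf (ω : Environment) : toEnvironment (gapsOf ω) = ω := by
  have hrec : ∀ k, target (gapsOf ω) k = target (gapsOf ω) (k - 1) + (ω.1 k - ω.1 (k - 1)) :=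
    fun k => target_eq _ k
  refine Subtype.ext (funext fun k => ?_)
  change target (gapsOf ω) k = ω.1 k
  induction k using Int.induction_on with
  | zero => rw [target_zero, ω.2.1]
  | succ k ih =>
    rw [hrec, add_sub_cancel_right, ih]
    ring
  | pred k ih =>
    have := hrec (-(k : ℤ))
    linarith

/-- `toEnvironment` has the measurable inverse `gapsOf`; pulling back along the inverse avoids any
measurability of `P`. -/
theorem ae_environmentLaw {F : Measure (Set.Ioi (0 : ℝ))} [IsProbabilityMeasure F]
    {P : Environment → Prop} (h : ∀ᵐ ζ ∂gapLaw F, P (toEnvironment ζ)) :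
    ∀ᵐ ω ∂environmentLaw F, P ω := by
  have hmap : (environmentLaw F).map gapsOf = gapLaw F := by
    rw [environmentLaw, Measure.map_map measurable_gapsOf measurable_toEnvironment]
    convert! Measure.map_id
    exact funext gapsOf_toEnvironment
  rw [← hmap] at h
  filter_upwards [ae_of_ae_map measurable_gapsOf.aemeasurable h] with ω hω
  rwa [toEnvironment_gapsOf] at hω

/-- In almost every environment, the collision times obey a law of large numbers. -/
theorem ae_ae_tendsto_collisionTime_div {F : Measure (Set.Ioi (0 : ℝ))} [IsProbabilityMeasure F]
    (hF : Integrable (fun x : Set.Ioi (0 : ℝ) => (x : ℝ)) F) {p : PMF ℤ}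
    (hsymm : ∀ k : ℤ, p (-k) = p k)
    (hsummable : Summable fun k : ℤ => (k : ℝ) ^ 2 * (p k).toReal) (h1 : 0 < (p 1).toReal) :
    ∀ᵐ ω ∂environmentLaw F, ∀ᵐ ξ ∂jumpLaw p,
      Tendsto (fun n : ℕ => collisionTime ω ξ n / n) atTop
        (𝓝 (meanAbsJump p * meanGap F)) := by
  refine ae_environmentLaw ?_
  have h := ae_tendsto_weightedLength_div hsummable (h := fun x => (x : ℝ))
    measurable_subtype_coe (fun x => x.2.le) hF hsymm h1
  -- The factors are exchanged so that Fubini puts the environment outside.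
  rw [← Measure.prod_swap] at h
  have h2 := Measure.ae_ae_of_ae_prod (ae_of_ae_map measurable_swap.aemeasurable h)
  filter_upwards [h2] with ζ hζ
  filter_upwards [hζ] with ξ hξ
  simp only [collisionTime_toEnvironment]
  exact hξ

theorem ae_tendsto_sum_gap_div {F : Measure (Set.Ioi (0 : ℝ))} [IsProbabilityMeasure F]
    (hF : Integrable (fun x : Set.Ioi (0 : ℝ) => (x : ℝ)) F) {e : ℕ → ℤ}
    (he : Function.Injective e) :
    ∀ᵐ ζ ∂gapLaw F, Tendsto (fun n : ℕ => (∑ i ∈ Finset.range n, (ζ (e i) : ℝ)) / n) atTop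
      (𝓝 (meanGap F)) := by
  have hmeas : Measurable fun x : Set.Ioi (0 : ℝ) => (x : ℝ) := measurable_subtype_coe
  have h := strong_law_ae_real (μ := gapLaw F) (fun i (ζ : Gaps) => (ζ (e i) : ℝ))
    ((measurePreserving_gap (e 0)).integrable_comp_of_integrable hF)
    (fun i j hij => (iIndepFun_comp_gap hmeas).indepFun (he.ne hij))
    (fun i => ?_)
  · rwa [integral_comp_gap (e 0) hmeas] at h
  · have hid : ∀ j : ℤ, (gapLaw F).map (fun ζ : Gaps => (ζ j : ℝ)) =
        F.map fun x : Set.Ioi (0 : ℝ) => (x : ℝ) := fun j => by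
      conv_rhs => rw [← (measurePreserving_gap (F := F) j).map_eq]
      rw [Measure.map_map hmeas (measurable_pi_apply j)]
      rfl
    exact ⟨(hmeas.comp (measurable_pi_apply (e i))).aemeasurable,
      (hmeas.comp (measurable_pi_apply (e 0))).aemeasurable, by rw [hid, hid]⟩

/-- In almost every environment, the targets have an asymptotic density. -/
theorem ae_exists_abs_target_sub_le {F : Measure (Set.Ioi (0 : ℝ))} [IsProbabilityMeasure F]
    (hF : Integrable (fun x : Set.Ioi (0 : ℝ) => (x : ℝ)) F) :
    ∀ᵐ ω ∂environmentLaw F, ∀ ε > 0, ∃ C : ℝ, ∀ k : ℤ,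
      |ω.1 k - meanGap F * k| ≤ ε * |(k : ℝ)| + C := by
  refine ae_environmentLaw ?_
  have hright := ae_tendsto_sum_gap_div hF (e := fun n => (n : ℤ) + 1)
    fun a b hab => by simpa using hab
  have hleft := ae_tendsto_sum_gap_div hF (e := fun n => -(n : ℤ))
    fun a b hab => by simpa using hab
  filter_upwards [hright, hleft] with ζ h1 h2
  intro ε hε
  have er : ∀ n : ℕ, target ζ n = ∑ i ∈ Finset.range n, (ζ ((i : ℤ) + 1) : ℝ) := fun n => by
    induction n with
    | zero => simpa using target_zero ζ
    | succ n ih =>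
      rw [Finset.sum_range_succ, ← ih, target_eq]
      push_cast
      rw [add_sub_cancel_right]
  have el : ∀ n : ℕ, target ζ (-n) = -∑ i ∈ Finset.range n, (ζ (-(i : ℤ)) : ℝ) := fun n => by
    induction n with
    | zero => simpa using target_zero ζ
    | succ n ih =>
      have h3 := target_eq ζ (-(n : ℤ))
      rw [Finset.sum_range_succ, neg_add, ← ih, h3]
      push_cast
      rw [show -((n : ℤ) + 1) = -(n : ℤ) - 1 by ring]
      ring
  have hseq : ∀ u : ℕ → ℝ, Tendsto (fun n : ℕ => u n / n) atTop (𝓝 (meanGap F)) →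
      ∃ C : ℝ, ∀ n : ℕ, |u n - meanGap F * n| ≤ ε * n + C := by
    intro u hu
    obtain ⟨N, hN⟩ := Metric.tendsto_atTop.1 hu ε hε
    -- The finitely many early terms, `n = 0` included, are absorbed into the constant.
    refine ⟨∑ n ∈ Finset.range (N + 1), |u n - meanGap F * n|, fun n => ?_⟩
    have hnn : 0 ≤ ∑ n ∈ Finset.range (N + 1), |u n - meanGap F * n| :=
      Finset.sum_nonneg fun _ _ => abs_nonneg _
    rcases Nat.lt_or_ge n (N + 1) with h | h
    · have := Finset.single_le_sum (f := fun n : ℕ => |u n - meanGap F * n|)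
        (fun _ _ => abs_nonneg _) (Finset.mem_range.2 h)
      have : 0 ≤ ε * n := by positivity
      linarith
    · have hn : (0 : ℝ) < n := by exact_mod_cast (by omega : 0 < n)
      have h3 := hN n (by omega)
      rw [Real.dist_eq] at h3
      have e : u n - meanGap F * n = (u n / n - meanGap F) * n := by field_simp
      rw [e, abs_mul, abs_of_pos hn]
      nlinarith
  obtain ⟨C1, hC1⟩ := hseq _ (h1.congr fun n => by rw [← er])
  obtain ⟨C2, hC2⟩ := hseq (fun n => -target ζ (-n)) (h2.congr fun n => by rw [el, neg_neg])
  refine ⟨max C1 C2, fun k => ?_⟩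
  change |target ζ k - meanGap F * k| ≤ _
  obtain ⟨n, rfl | rfl⟩ := k.eq_nat_or_neg
  · have := hC1 n
    simp only [Int.cast_natCast, Nat.abs_cast]
    linarith [le_max_left C1 C2]
  · have := hC2 n
    rw [abs_sub_comm] at this
    simp only [Int.cast_neg, Int.cast_natCast, abs_neg, Nat.abs_cast]
    rw [show target ζ (-(n : ℤ)) - meanGap F * -(n : ℝ) = meanGap F * n - -target ζ (-n) by ring]
    linarith [le_max_right C1 C2]

/-! ### The central limit theorem in a fixed environment -/

/-- A deterministic comparison. The collision count `n` satisfies `a ≤ n < b`. The particle is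
within one crossing of target `walk ξ n`, which costs `2 (ε R + C) + 2 c D`; linearizing that target
costs `ε R + C`, and moving from index `n` to `m` costs `2 c D`. -/
theorem abs_position_sub_mul_walk_le {ω : Environment} {ξ : ℕ → ℤ} {m a b : ℕ} {t : ℝ≥0}
    {c ε C D R : ℝ} (hω : ∀ k : ℤ, |ω.1 k - c * k| ≤ ε * |(k : ℝ)| + C) (hc : 0 ≤ c) (hε : 0 ≤ ε)
    (hτ : Tendsto (collisionTime ω ξ) atTop atTop) (ha : collisionTime ω ξ a ≤ t)
    (hb : t < collisionTime ω ξ b) (ham : a ≤ m) (hmb : m ≤ b)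
    (hD : ∀ k, a ≤ k → k ≤ b → |(walk ξ k : ℝ) - walk ξ a| ≤ D)
    (hR : ∀ k ≤ b, |(walk ξ k : ℝ)| ≤ R) :
    |position ω ξ t - c * walk ξ m| ≤ 3 * (ε * R + C) + 4 * (c * D) := by
  obtain ⟨n, h1, h2⟩ := exists_collision ω ξ hτ t
  have han : a ≤ n := by
    by_contra hcon
    have := collisionTime_mono ω ξ (show n + 1 ≤ a by omega)
    linarith
  have hnb : n + 1 ≤ b := by
    by_contra hcon
    have := collisionTime_mono ω ξ (show b ≤ n by omega)
    linarith
  have hpos : |position ω ξ t - ω.1 (walk ξ n)| ≤ |ω.1 (walk ξ (n + 1)) - ω.1 (walk ξ n)| := by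
    rw [position_eq ω ξ n t h1 h2, add_sub_cancel_left]
    refine (abs_sign_mul_le _ _).trans ?_
    rw [abs_of_nonneg (sub_nonneg.2 h1)]
    have : collisionTime ω ξ (n + 1) = collisionTime ω ξ n +
        |ω.1 (walk ξ (n + 1)) - ω.1 (walk ξ n)| := by
      simp [collisionTime, Finset.sum_range_succ]
    linarith
  have hdev : ∀ k ≤ b, |ω.1 (walk ξ k) - c * walk ξ k| ≤ ε * R + C := fun k hk =>
    (hω _).trans (by gcongr; exact hR k hk)
  have hstep : ∀ k l, a ≤ k → k ≤ b → a ≤ l → l ≤ b →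
      |c * (walk ξ k : ℝ) - c * walk ξ l| ≤ 2 * (c * D) := fun k l hk hk' hl hl' => by
    rw [← mul_sub, abs_mul, abs_of_nonneg hc]
    have h3 := abs_sub_le (walk ξ k : ℝ) (walk ξ a) (walk ξ l)
    rw [abs_sub_comm (walk ξ a : ℝ)] at h3
    have h4 := hD k hk hk'
    have h5 := hD l hl hl'
    nlinarith
  have d1 := abs_le.1 (hdev n (by omega))
  have d2 := abs_le.1 (hdev (n + 1) hnb)
  have s1 := abs_le.1 (hstep (n + 1) n (by omega) hnb han (by omega))
  have s2 := abs_le.1 (hstep n m han (by omega) ham hmb)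
  have hω2 : |ω.1 (walk ξ (n + 1)) - ω.1 (walk ξ n)| ≤ 2 * (ε * R + C) + 2 * (c * D) :=
    abs_le.2 ⟨by linarith, by linarith⟩
  have p1 := abs_le.1 (hpos.trans hω2)
  exact abs_le.2 ⟨by linarith, by linarith⟩

/-- Continuity from above at the null upper limit of the sets. It turns an almost sure statement
into one exceptional set that serves all `n ≥ n₀`. -/
theorem exists_measure_exists_ge_lt {Ω : Type*} [MeasurableSpace Ω] {μ : Measure Ω}
    [IsFiniteMeasure μ] {E : ℕ → Set Ω} (hE : ∀ n, MeasurableSet (E n))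
    (h : ∀ᵐ x ∂μ, ∀ᶠ n in atTop, x ∉ E n) {η : ENNReal} (hη : 0 < η) :
    ∃ n₀, μ (⋃ n ≥ n₀, E n) < η := by
  have hanti : Antitone fun n₀ => ⋃ n ≥ n₀, E n := fun a b hab =>
    Set.biUnion_subset_biUnion_left fun n hn => le_trans hab hn
  have hlim : Tendsto (fun n₀ => μ (⋃ n ≥ n₀, E n)) atTop (𝓝 (μ (⋂ n₀, ⋃ n ≥ n₀, E n))) :=
    tendsto_measure_iInter_atTop (fun n₀ => (MeasurableSet.iUnion fun n =>
      MeasurableSet.iUnion fun _ => hE n).nullMeasurableSet) hanti ⟨0, measure_ne_top _ _⟩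
  have hzero : μ (⋂ n₀, ⋃ n ≥ n₀, E n) = 0 := by
    refine measure_mono_null (fun x hx => ?_) h
    simp only [Set.mem_iInter, Set.mem_iUnion] at hx
    simp only [Set.mem_compl_iff, Set.mem_ofPred_eq, eventually_atTop, not_exists, not_forall,
      not_not]
    intro n₀
    obtain ⟨n, hn, hxn⟩ := hx n₀
    exact ⟨n, hn, hxn⟩
  rw [hzero] at hlim
  exact (hlim.eventually_lt_const hη).exists

theorem tendsto_collisionTime_of_div {ω : Environment} {ξ : ℕ → ℤ} {c : ℝ} (hc : 0 < c)
    (h : Tendsto (fun n : ℕ => collisionTime ω ξ n / n) atTop (𝓝 c)) :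
    Tendsto (collisionTime ω ξ) atTop atTop := by
  have h1 := h.pos_mul_atTop hc (tendsto_natCast_atTop_atTop (R := ℝ))
  refine h1.congr' ?_
  filter_upwards [eventually_gt_atTop 0] with n hn
  have : (n : ℝ) ≠ 0 := by positivity
  field_simp

theorem path_eq_position {ω : Environment} {ξ : ℕ → ℤ}
    (h : Tendsto (collisionTime ω ξ) atTop atTop) (t : ℝ≥0) :
    (path ω ξ).1 t = position ω ξ t := by
  rw [path, dif_pos h]

/-! ### Change of time from collisions to `t`, and Slutsky's lemma. -/

section Quenched

variable {p : PMF ℤ} (hsummable : Summable fun k : ℤ => (k : ℝ) ^ 2 * (p k).toReal)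
  (hsymm : ∀ k : ℤ, p (-k) = p k)

/-- With high probability, the number of collisions up to a large time `t` lies in a small window
around `t / c`. -/
theorem exists_measure_window_compl_lt {ω : Environment} {c δ : ℝ} (hc : 0 < c) (hδ : 0 < δ)
    (hδ1 : δ < 1)
    (hlln : ∀ᵐ ξ ∂jumpLaw p, Tendsto (fun n : ℕ => collisionTime ω ξ n / n) atTop (𝓝 c))
    {η : ENNReal} (hη : 0 < η) :
    ∀ᶠ t : ℝ≥0 in atTop, jumpLaw p {ξ | ¬ (collisionTime ω ξ ⌊(1 - δ) * (c⁻¹ * t)⌋₊ ≤ t ∧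
      t < collisionTime ω ξ ⌈(1 + δ) * (c⁻¹ * t)⌉₊)} < η := by
  -- The tolerance `δ / 3` works because `(1 + δ/3)(1 - δ) ≤ 1 < (1 - δ/3)(1 + δ)` for `0 < δ < 1`.
  set E : ℕ → Set (ℕ → ℤ) := fun n => {ξ | (δ / 3 * c) * n < |collisionTime ω ξ n - c * n|}
  have hE : ∀ n, MeasurableSet (E n) := fun n => measurableSet_lt measurable_const
    ((measurable_collisionTime ω n).sub_const _).abs
  obtain ⟨n₀, hn₀⟩ := exists_measure_exists_ge_lt (μ := jumpLaw p) hE (by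
    filter_upwards [hlln] with ξ hξ
    have h1 := Metric.tendsto_atTop.1 hξ (δ / 3 * c) (by positivity)
    obtain ⟨N, hN⟩ := h1
    filter_upwards [eventually_ge_atTop (max N 1)] with n hn
    have hn0 : (0 : ℝ) < n := by exact_mod_cast (le_of_max_le_right hn)
    have h2 := hN n (le_of_max_le_left hn)
    rw [Real.dist_eq] at h2
    simp only [E, Set.mem_ofPred_eq, not_lt]
    have e : collisionTime ω ξ n - c * n = (collisionTime ω ξ n / n - c) * n := by field_simp
    rw [e, abs_mul, abs_of_pos hn0]
    gcongr) hη
  have hcoe : Tendsto (fun t : ℝ≥0 => (t : ℝ)) atTop atTop := NNReal.tendsto_coe_atTop.2 tendsto_id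
  have hlarge := (hcoe.const_mul_atTop (show 0 < c⁻¹ by positivity)).const_mul_atTop
    (show 0 < 1 - δ by linarith)
  filter_upwards [hlarge.eventually_ge_atTop (n₀ + 1), eventually_gt_atTop 0] with t ht ht0
  refine lt_of_le_of_lt (measure_mono fun ξ hξ => ?_) hn₀
  by_contra hcon
  apply hξ
  simp only [E, Set.mem_iUnion, not_exists, Set.mem_ofPred_eq, not_lt] at hcon
  have ht0' : (0 : ℝ) < t := by exact_mod_cast ht0
  have hs : 0 < c⁻¹ * (t : ℝ) := by positivity
  have hcs : c * (c⁻¹ * (t : ℝ)) = t := by field_simp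
  set s := c⁻¹ * (t : ℝ)
  have ha1 : (⌊(1 - δ) * s⌋₊ : ℝ) ≤ (1 - δ) * s := Nat.floor_le (by nlinarith)
  have ha2 : n₀ ≤ ⌊(1 - δ) * s⌋₊ := Nat.le_floor (by linarith)
  have hb1 : (1 + δ) * s ≤ (⌈(1 + δ) * s⌉₊ : ℝ) := Nat.le_ceil _
  have hb2 : n₀ ≤ ⌈(1 + δ) * s⌉₊ := by
    have : (n₀ : ℝ) ≤ ⌈(1 + δ) * s⌉₊ := by nlinarith
    exact_mod_cast this
  have h1 := abs_le.1 (hcon _ ha2)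
  have h2 := abs_le.1 (hcon _ hb2)
  constructor
  · have h3 : collisionTime ω ξ ⌊(1 - δ) * s⌋₊ ≤ c * (1 + δ / 3) * ⌊(1 - δ) * s⌋₊ := by linarith
    have h4 : c * (1 + δ / 3) * (⌊(1 - δ) * s⌋₊ : ℝ) ≤ c * (1 + δ / 3) * ((1 - δ) * s) := by gcongr
    have h5 : c * (1 + δ / 3) * ((1 - δ) * s) = (1 + δ / 3) * (1 - δ) * (c * s) := by ring
    rw [hcs] at h5
    have h6 : (1 + δ / 3) * (1 - δ) ≤ 1 := by nlinarith
    nlinarith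
  · have h3 : c * (1 - δ / 3) * ⌈(1 + δ) * s⌉₊ ≤ collisionTime ω ξ ⌈(1 + δ) * s⌉₊ := by linarith
    have h7 : 0 ≤ c * (1 - δ / 3) := mul_nonneg hc.le (by linarith)
    have h4 : c * (1 - δ / 3) * ((1 + δ) * s) ≤ c * (1 - δ / 3) * (⌈(1 + δ) * s⌉₊ : ℝ) := by gcongr
    have h5 : c * (1 - δ / 3) * ((1 + δ) * s) = (1 - δ / 3) * (1 + δ) * (c * s) := by ring
    rw [hcs] at h5
    have h6 : 1 < (1 - δ / 3) * (1 + δ) := by nlinarith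
    nlinarith

include hsummable hsymm

/-- The collision count depends on the walk, so it is replaced by a deterministic time as in
Anscombe's theorem. Off three events of probability at most `η` (the count leaves its window, the
walk is too large, the walk oscillates in the window) and a null set, `abs_position_sub_mul_walk_le`
applies. -/
theorem tendsto_measure_le_abs_path_sub {ω : Environment} {c g : ℝ} (hc : 0 < c) (hg : 0 < g)
    (hlln : ∀ᵐ ξ ∂jumpLaw p, Tendsto (fun n : ℕ => collisionTime ω ξ n / n) atTop (𝓝 c))
    (hω : ∀ ε > 0, ∃ C : ℝ, ∀ k : ℤ, |ω.1 k - g * k| ≤ ε * |(k : ℝ)| + C) {ε : ℝ} (hε : 0 < ε) :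
    Tendsto (fun t : ℝ≥0 => jumpLaw p {ξ | ε * √t ≤
      |(path ω ξ).1 t - g * walk ξ ⌊c⁻¹ * t⌋₊|}) atTop (𝓝 0) := by
  have hv : 0 ≤ jumpVariance p := tsum_nonneg fun k => by positivity
  rw [ENNReal.tendsto_nhds_zero]
  intro η' hη'
  obtain ⟨η, hη, hηη'⟩ : ∃ η : ℝ, 0 < η ∧ ENNReal.ofReal (3 * η) ≤ η' := by
    rcases eq_or_ne η' ⊤ with rfl | htop
    · exact ⟨1, one_pos, le_top⟩
    · refine ⟨η'.toReal / 3, by have := ENNReal.toReal_pos hη'.ne' htop; positivity, ?_⟩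
      rw [mul_div_cancel₀ _ (by norm_num), ENNReal.ofReal_toReal htop]
  -- Kolmogorov's inequality up to `b ≤ (2 / c + 1) t` at level `R √t`.
  obtain ⟨R, hR, hRη⟩ : ∃ R : ℝ, 0 < R ∧ (2 * c⁻¹ + 1) * jumpVariance p / R ^ 2 ≤ η := by
    refine ⟨√((2 * c⁻¹ + 1) * jumpVariance p / η) + 1, by positivity, ?_⟩
    have h0 : 0 ≤ (2 * c⁻¹ + 1) * jumpVariance p / η := by positivity
    rw [div_le_iff₀ (by positivity), ← div_le_iff₀' hη]
    nlinarith [Real.sq_sqrt h0, Real.sqrt_nonneg ((2 * c⁻¹ + 1) * jumpVariance p / η)]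
  -- The oscillation then costs `4 g ρ √t = (ε / 8) √t`; with the slope `ε / (16 R)` below, the
  -- total error is at most `(ε / 2) √t`.
  set ρ := ε / (32 * g) with hρ
  have hρ0 : 0 < ρ := by positivity
  obtain ⟨δ, hδ, hδ1, hδη⟩ : ∃ δ : ℝ, 0 < δ ∧ δ < 1 ∧
      (4 * δ * c⁻¹) * jumpVariance p / ρ ^ 2 ≤ η := by
    have hlim : Tendsto (fun δ : ℝ => (4 * δ * c⁻¹) * jumpVariance p / ρ ^ 2) (𝓝[>] 0) (𝓝 0) := by
      have : ContinuousAt (fun δ : ℝ => (4 * δ * c⁻¹) * jumpVariance p / ρ ^ 2) 0 := by fun_prop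
      have h2 := this.tendsto.mono_left (nhdsWithin_le_nhds (s := Set.Ioi 0))
      simpa using h2
    obtain ⟨δ, h1, h2⟩ := ((hlim.eventually_le_const hη).and
      (Ioo_mem_nhdsGT (show (0 : ℝ) < 1 by norm_num))).exists
    exact ⟨δ, h2.1, h2.2, h1⟩
  obtain ⟨C, hC⟩ := hω (ε / (16 * R)) (by positivity)
  have hcoe : Tendsto (fun t : ℝ≥0 => (t : ℝ)) atTop atTop := NNReal.tendsto_coe_atTop.2 tendsto_id
  have hwin := exists_measure_window_compl_lt hc hδ hδ1 hlln (ENNReal.ofReal_pos.2 hη)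
  filter_upwards [hwin, eventually_gt_atTop 0, hcoe.eventually_ge_atTop 1,
    hcoe.eventually_ge_atTop (c / δ),
    (Real.tendsto_sqrt_atTop.comp hcoe).eventually_ge_atTop (16 * C / ε)] with t ht1 ht0 ht2 ht3 ht4
  have ht0' : (0 : ℝ) < t := by exact_mod_cast ht0
  have hsqrt : 0 < √(t : ℝ) := by positivity
  have hsqrt2 : √(t : ℝ) ^ 2 = t := Real.sq_sqrt ht0'.le
  have hs : 0 < c⁻¹ * (t : ℝ) := by positivity
  have hsδ : 1 ≤ δ * (c⁻¹ * t) := by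
    rw [div_le_iff₀ hδ] at ht3
    rw [← mul_assoc, mul_comm δ, mul_assoc, inv_mul_eq_div, le_div_iff₀ hc]
    linarith
  set s := c⁻¹ * (t : ℝ) with hsdef
  set a := ⌊(1 - δ) * s⌋₊ with hadef
  set b := ⌈(1 + δ) * s⌉₊ with hbdef
  have ham : a ≤ ⌊s⌋₊ := Nat.floor_le_floor (by nlinarith)
  have hmb : ⌊s⌋₊ ≤ b := by
    have h1 : (⌊s⌋₊ : ℝ) ≤ s := Nat.floor_le hs.le
    have h2 : (1 + δ) * s ≤ b := Nat.le_ceil _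
    have : (⌊s⌋₊ : ℝ) ≤ b := by nlinarith
    exact_mod_cast this
  have hb1 : (b : ℝ) < (1 + δ) * s + 1 := Nat.ceil_lt_add_one (by nlinarith)
  have ha1 : (1 - δ) * s < a + 1 := Nat.lt_floor_add_one _
  -- Rounding adds at most `2` to the width `2 δ s`, and `1 ≤ δ s`.
  have hab : ((b - a : ℕ) : ℝ) ≤ 4 * δ * s := by
    rw [Nat.cast_sub (by omega)]
    linarith
  have hb2 : (b : ℝ) ≤ (2 * c⁻¹ + 1) * t := by
    have : δ * s ≤ s := by nlinarith
    have e : (2 * c⁻¹ + 1) * (t : ℝ) = 2 * s + t := by rw [hsdef]; ring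
    rw [e]
    linarith
  have hsub : {ξ | ε * √t ≤ |(path ω ξ).1 t - g * walk ξ ⌊s⌋₊|} ⊆
      ({ξ | ¬ (collisionTime ω ξ a ≤ t ∧ t < collisionTime ω ξ b)} ∪
        {ξ | ∃ k ≤ b, R * √t ≤ |(walk ξ k : ℝ)|}) ∪
        ({ξ | ∃ k ≤ b - a, ρ * √t ≤ |(walk ξ (a + k) : ℝ) - walk ξ a|} ∪
          {ξ | ¬ Tendsto (fun n : ℕ => collisionTime ω ξ n / n) atTop (𝓝 c)}) := by
    intro ξ hξ
    by_contra hcon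
    rw [Set.mem_union, Set.mem_union, Set.mem_union, not_or, not_or, not_or] at hcon
    obtain ⟨⟨h12, h3⟩, h4, h5⟩ := hcon
    obtain ⟨h1, h2⟩ := of_not_not h12
    replace h5 := of_not_not h5
    simp only [Set.mem_ofPred_eq, not_exists, not_and, not_le] at h3 h4 hξ
    have hτ := tendsto_collisionTime_of_div hc h5
    have key := abs_position_sub_mul_walk_le (m := ⌊s⌋₊) (D := ρ * √t) (R := R * √t) hC hg.le
      (by positivity) hτ h1 h2 ham hmb (fun k hk hk' => by
        have := h4 (k - a) (by omega)
        rw [Nat.add_sub_cancel' hk] at this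
        exact this.le) (fun k hk => (h3 k hk).le)
    rw [path_eq_position hτ] at hξ
    have e1 : ε / (16 * R) * (R * √t) = ε / 16 * √t := by field_simp
    have e2 : 4 * (g * (ρ * √t)) = ε / 8 * √t := by rw [hρ]; field_simp; norm_num
    have e3 : C ≤ ε / 16 * √t := by
      have : 16 * C / ε ≤ √t := ht4
      rw [div_le_iff₀ hε] at this
      linarith
    rw [e1, e2] at key
    have : 0 < ε * √t := by positivity
    linarith
  have m2 : jumpLaw p {ξ | ∃ k ≤ b, R * √t ≤ |(walk ξ k : ℝ)|} ≤ ENNReal.ofReal η := by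
    refine (measure_exists_le_abs_walk hsummable hsymm b (by positivity)).trans
      (ENNReal.ofReal_le_ofReal (le_trans ?_ hRη))
    rw [mul_pow, hsqrt2, div_le_div_iff₀ (by positivity) (by positivity)]
    calc b * jumpVariance p * R ^ 2 ≤ ((2 * c⁻¹ + 1) * t) * jumpVariance p * R ^ 2 := by gcongr
      _ = _ := by ring
  have m3 : jumpLaw p {ξ | ∃ k ≤ b - a, ρ * √t ≤ |(walk ξ (a + k) : ℝ) - walk ξ a|} ≤
      ENNReal.ofReal η := by
    refine (measure_exists_le_abs_walk_sub hsummable hsymm a (b - a) (by positivity)).trans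
      (ENNReal.ofReal_le_ofReal (le_trans ?_ hδη))
    rw [mul_pow, hsqrt2, div_le_div_iff₀ (by positivity) (by positivity)]
    calc ((b - a : ℕ) : ℝ) * jumpVariance p * ρ ^ 2 ≤ (4 * δ * s) * jumpVariance p * ρ ^ 2 := by
          gcongr
      _ = _ := by rw [hsdef]; ring
  have m4 : jumpLaw p {ξ | ¬ Tendsto (fun n : ℕ => collisionTime ω ξ n / n) atTop (𝓝 c)} = 0 :=
    hlln
  calc jumpLaw p {ξ | ε * √t ≤ |(path ω ξ).1 t - g * walk ξ ⌊s⌋₊|}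
      ≤ (ENNReal.ofReal η + ENNReal.ofReal η) + (ENNReal.ofReal η + 0) :=
        (measure_mono hsub).trans ((measure_union_le _ _).trans (add_le_add
          ((measure_union_le _ _).trans (add_le_add ht1.le m2))
          ((measure_union_le _ _).trans (add_le_add m3 m4.le))))
    _ = ENNReal.ofReal (3 * η) := by
        rw [add_zero, ← ENNReal.ofReal_add hη.le hη.le, ← ENNReal.ofReal_add (by positivity) hη.le]
        congr 1
        ring
    _ ≤ η' := hηη'

/-- Slutsky's lemma: the central limit theorem at time `⌊t / c⌋`, multiplied by a deterministic
ratio that tends to `g / √c`. -/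
theorem tendstoInDistribution_walk_floor {c : ℝ} (hc : 0 < c) (g : ℝ) :
    TendstoInDistribution (fun (t : ℝ≥0) (ξ : ℕ → ℤ) => g * walk ξ ⌊c⁻¹ * (t : ℝ)⌋₊ / √t) atTop
      (fun z : ℝ => z * (g * √c⁻¹)) (fun _ => jumpLaw p)
      (gaussianReal 0 (jumpVariance p).toNNReal) := by
  have hcoe : Tendsto (fun t : ℝ≥0 => (t : ℝ)) atTop atTop := NNReal.tendsto_coe_atTop.2 tendsto_id
  have hfloor : Tendsto (fun t : ℝ≥0 => ⌊c⁻¹ * (t : ℝ)⌋₊) atTop atTop :=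
    tendsto_nat_floor_atTop.comp (hcoe.const_mul_atTop (show 0 < c⁻¹ by positivity))
  have hw := tendstoInDistribution_walk hsummable hsymm
  have hcomp : TendstoInDistribution
      (fun (t : ℝ≥0) (ξ : ℕ → ℤ) => (√(⌊c⁻¹ * (t : ℝ)⌋₊ : ℝ))⁻¹ * (walk ξ ⌊c⁻¹ * (t : ℝ)⌋₊ : ℝ))
      atTop (fun z : ℝ => z) (fun _ => jumpLaw p) (gaussianReal 0 (jumpVariance p).toNNReal) :=
    ⟨fun t => hw.forall_aemeasurable _, hw.aemeasurable_limit, hw.tendsto.comp hfloor⟩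
  have hratio : Tendsto (fun t : ℝ≥0 => g * (√(⌊c⁻¹ * (t : ℝ)⌋₊ : ℝ) / √t)) atTop
      (𝓝 (g * √c⁻¹)) := by
    have h1 := (tendsto_nat_floor_mul_div_atTop (show 0 ≤ c⁻¹ by positivity)).comp hcoe
    have h2 := ((Real.continuous_sqrt.tendsto _).comp h1).const_mul g
    refine h2.congr fun t => ?_
    simp only [Function.comp_apply]
    rw [Real.sqrt_div (Nat.cast_nonneg _)]
  have hconst : TendstoInMeasure (jumpLaw p)
      (fun (t : ℝ≥0) (_ : ℕ → ℤ) => g * (√(⌊c⁻¹ * (t : ℝ)⌋₊ : ℝ) / √t)) atTop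
      (fun _ => g * √c⁻¹) := by
    rw [tendstoInMeasure_iff_norm]
    intro ε hε
    refine tendsto_const_nhds.congr' ?_
    filter_upwards [Metric.tendsto_nhds.1 hratio ε hε] with t ht
    rw [Real.dist_eq, ← Real.norm_eq_abs] at ht
    symm
    convert! measure_empty (μ := jumpLaw p)
    ext ξ
    simpa only [Set.mem_ofPred_eq, Set.mem_empty_iff_false, iff_false, not_le] using ht
  have h := hcomp.continuous_comp_prodMk_of_tendstoInMeasure_const
    (g := fun z : ℝ × ℝ => z.1 * z.2) (by fun_prop) hconst fun t => aemeasurable_const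
  refine h.congr (fun t => ae_of_all _ fun ξ => ?_) (ae_of_all _ fun _ => rfl)
  dsimp only
  generalize ⌊c⁻¹ * (t : ℝ)⌋₊ = m
  -- For `m = 0` the inverse square root is `0` by convention, and the walk is `0` as well.
  rcases Nat.eq_zero_or_pos m with h0 | h0
  · simp [h0, walk]
  · have : √(m : ℝ) ≠ 0 := by positivity
    field_simp

theorem tendstoInDistribution_path {ω : Environment} {c g : ℝ} (hc : 0 < c) (hg : 0 < g)
    (hlln : ∀ᵐ ξ ∂jumpLaw p, Tendsto (fun n : ℕ => collisionTime ω ξ n / n) atTop (𝓝 c))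
    (hω : ∀ ε > 0, ∃ C : ℝ, ∀ k : ℤ, |ω.1 k - g * k| ≤ ε * |(k : ℝ)| + C) :
    TendstoInDistribution (fun (t : ℝ≥0) (ξ : ℕ → ℤ) => (path ω ξ).1 t / √t) atTop
      (fun z : ℝ => z * (g * √c⁻¹)) (fun _ => jumpLaw p)
      (gaussianReal 0 (jumpVariance p).toNNReal) := by
  refine tendstoInDistribution_of_tendstoInMeasure_sub _ _
    (tendstoInDistribution_walk_floor hsummable hsymm hc g) ?_ fun t => ?_
  · rw [tendstoInMeasure_iff_norm]
    intro ε hε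
    refine (tendsto_measure_le_abs_path_sub hsummable hsymm hc hg hlln hω hε).congr' ?_
    filter_upwards [eventually_gt_atTop 0] with t ht
    have hsqrt : 0 < √(t : ℝ) := Real.sqrt_pos.2 (by exact_mod_cast ht)
    congr 1
    ext ξ
    simp only [Set.mem_ofPred_eq, Pi.sub_apply, Pi.zero_apply, sub_zero, Real.norm_eq_abs]
    rw [← sub_div, abs_div, abs_of_pos hsqrt, le_div_iff₀ hsqrt]
  · exact (((measurable_pi_apply t).comp (measurable_subtype_coe.comp
      (measurable_path ω))).div_const _).aemeasurable

end Quenched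

theorem meanGap_pos {F : Measure (Set.Ioi (0 : ℝ))} [IsProbabilityMeasure F]
    (hF : Integrable (fun x : Set.Ioi (0 : ℝ) => (x : ℝ)) F) : 0 < meanGap F := by
  rw [meanGap, integral_pos_iff_support_of_nonneg (fun x => x.2.le) hF]
  have : Function.support (fun x : Set.Ioi (0 : ℝ) => (x : ℝ)) = Set.univ := by
    ext x
    simpa using x.2.ne'
  rw [this]
  simp

/-- Convergence in distribution depends only on laws, so it passes from the space of jumps to path
space, and the scaled Gaussian becomes a Gaussian of variance `k ^ 2 * v`. -/
theorem tendstoInDistribution_quenchedLaw {p : PMF ℤ} {ω : Environment} {k : ℝ} {v w : ℝ≥0}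
    (hw : (w : ℝ) = k ^ 2 * v)
    (h : TendstoInDistribution (fun (t : ℝ≥0) (ξ : ℕ → ℤ) => (path ω ξ).1 t / √t) atTop
      (fun z : ℝ => z * k) (fun _ => jumpLaw p) (gaussianReal 0 v)) :
    TendstoInDistribution (fun (t : ℝ≥0) (X : PathSpace) => X.1 t / √t) atTop (fun z : ℝ => z)
      (fun _ : ℝ≥0 => quenchedLaw p ω) (gaussianReal 0 w) := by
  have hmeas : ∀ t : ℝ≥0, Measurable fun X : PathSpace => X.1 t / √t := fun t =>
    ((measurable_pi_apply t).comp measurable_subtype_coe).div_const _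
  have e1 : ∀ t : ℝ≥0, (quenchedLaw p ω).map (fun X : PathSpace => X.1 t / √t) =
      (jumpLaw p).map fun ξ => (path ω ξ).1 t / √t := fun t => by
    rw [quenchedLaw, Measure.map_map (hmeas t) (measurable_path ω)]
    rfl
  have e2 : (gaussianReal 0 w).map (fun z : ℝ => z) =
      (gaussianReal 0 v).map fun z : ℝ => z * k := by
    rw [gaussianReal_map_mul_const, mul_zero, show (fun z : ℝ => z) = id from rfl, Measure.map_id]
    congr 1
    exact NNReal.eq hw
  refine ⟨fun t => (hmeas t).aemeasurable, aemeasurable_id, ?_⟩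
  simp only [e1, e2]
  exact h.tendsto

end LevyWalk

theorem theorem1
    (F : Measure (Set.Ioi (0 : ℝ))) [IsProbabilityMeasure F]
    (hF : Integrable (fun x : Set.Ioi (0 : ℝ) => (x : ℝ)) F)
    (p : PMF ℤ)
    (hsymm : ∀ k : ℤ, p (-k) = p k)
    (hmono : ∀ k : ℤ, 1 ≤ k → p (k + 1) ≤ p k)
    (hsummable : Summable fun k : ℤ => (k : ℝ) ^ 2 * (p k).toReal)
    (hpos : 0 < LevyWalk.jumpVariance p) :
    Tendsto (fun n : ℕ => (∫ ξ, |(LevyWalk.walk ξ n : ℝ)| ^ 2 ∂LevyWalk.jumpLaw p) / (n : ℝ))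
      atTop (𝓝 (LevyWalk.jumpVariance p)) ∧
    ∀ᵐ ω ∂LevyWalk.environmentLaw F,
      TendstoInDistribution (fun (t : ℝ≥0) (X : LevyWalk.PathSpace) => X.1 t / Real.sqrt t)
        atTop (fun z : ℝ => z) (fun _ : ℝ≥0 => LevyWalk.quenchedLaw p ω)
        (gaussianReal 0
          (LevyWalk.meanGap F / LevyWalk.meanAbsJump p * LevyWalk.jumpVariance p).toNNReal) := by
  refine ⟨LevyWalk.tendsto_integral_walk_sq_div hsummable hsymm, ?_⟩
  have hm := LevyWalk.meanAbsJump_pos hsummable hpos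
  have hg := LevyWalk.meanGap_pos hF
  have hc := mul_pos hm hg
  filter_upwards [LevyWalk.ae_ae_tendsto_collisionTime_div hF hsymm hsummable
      (LevyWalk.apply_one_pos hsymm hmono hpos), LevyWalk.ae_exists_abs_target_sub_le hF]
    with ω hlln hω
  refine LevyWalk.tendstoInDistribution_quenchedLaw ?_
    (LevyWalk.tendstoInDistribution_path hsummable hsymm hc hg hlln hω)
  -- The scale is `μ / √(m̄ μ)`, whose square is `μ / m̄`.
  rw [Real.coe_toNNReal _ (by positivity), Real.coe_toNNReal _ hpos.le, mul_pow,
    Real.sq_sqrt (by positivity)]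
  field_simp
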